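/- For $m<1$ let $K(m)=\int_0^{\pi/2}\frac{d\varphi}{\sqrt{1-m\sin^2\varphi}}$ and $E(m)=\int_0^{\pi/2}\sqrt{1-m\sin^2\varphi}\,d\varphi$ be the complete elliptic integrals with parameter $m$. For the KdV equation $u_t+6uu_x+\epsilon^2u_{xxx}=0$ with the pure step initial condition ($u=1$ for $x<0$, $u=0$ for $x>0$), the long-time phase obtained by Egorova, Gladka and Teschl from the inverse scattering transform is, for $\epsilon>0$, $t>0$, $-6t<x<4t$ and $\xi=\frac{x}{12t}$, $$\theta=\frac{tB(\xi)}{2\pi\epsilon}+\frac{\Delta(\xi)}{2\pi}\pm\frac12,$$ $$B(\xi)=24\int_{\sqrt m}^1\Big(\xi+\frac{1-m}2-s^2\Big)\sqrt{\frac{s^2-m}{1-s^2}}\,ds,\qquad \Delta(\xi)=\frac1{K(m)}\int_{\sqrt m}^1\frac{\log\big(4s\sqrt{1-s^2}\big)}{\sqrt{(1-s^2)(s^2-m)}}\,ds,$$ where $m=m(\xi)\in(0,1)$ is given implicitly by $$\int_0^{\sqrt m}\Big(\xi+\frac{1-m}2-s^2\Big)\sqrt{\frac{m-s^2}{1-s^2}}\,ds=0.\qquad(*)$$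 Then: 1. Equation $(*)$ has exactly one solution $m\in(0,1)$, and for $m\in(0,1)$ it is equivalent to the Gurevich–Pitaevskii equation $$\frac xt=2(1+m)-\frac{4m(1-m)K(m)}{E(m)-(1-m)K(m)}.$$ 2. For $m=m(\xi)$ the integrals above converge, $K(m)>0$, $E(m)-(1-m)K(m)>0$, and the leading part of the phase equals the Whitham fast phase (where $K'=dK/dm$, and $K$ is differentiable at $m$): $$\frac{tB(\xi)}{2\pi\epsilon}=-\frac{t}{\epsilon K'(m)}=-\frac t\epsilon\cdot\frac{2m(1-m)}{E(m)-(1-m)K(m)}.$$ 3. For either choice of the sign, the $O(1)$ shift is $$\theta_*=\frac{\Delta(\xi)}{2\pi}\pm\frac12=\frac{K(1-m)}{2\pi K(m)}\log\big[4(m(1-m))^{1/4}\big]-\frac18\pm\frac12.$$ Consequently $\theta$ is the sum of the right-hand sides in 2 and 3. -/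

import Mathlib

open Set MeasureTheory intervalIntegral

noncomputable section

/-- Complete elliptic integral of the first kind `K(m)`, as a function of the parameter `m < 1`. -/
def ellipticK (m : ℝ) : ℝ :=
  ∫ φ in (0 : ℝ)..(Real.pi / 2), 1 / Real.sqrt (1 - m * Real.sin φ ^ 2)

/-- Complete elliptic integral of the second kind `E(m)`, as a function of the parameter `m ≤ 1`. -/
def ellipticE (m : ℝ) : ℝ :=
  ∫ φ in (0 : ℝ)..(Real.pi / 2), Real.sqrt (1 - m * Real.sin φ ^ 2)

/-- The integrand of the equation that determines the elliptic parameter `m(ξ)`. -/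
def modulusIntegrand (ξ m s : ℝ) : ℝ :=
  (ξ + (1 - m) / 2 - s ^ 2) * Real.sqrt ((m - s ^ 2) / (1 - s ^ 2))

/-- The left-hand side of the implicit equation for the elliptic parameter `m(ξ)`. -/
def modulusIntegral (ξ m : ℝ) : ℝ :=
  ∫ s in (0 : ℝ)..(Real.sqrt m), modulusIntegrand ξ m s

/-- `m` is a value in `(0, 1)` of the elliptic parameter given implicitly at `ξ`. -/
def IsStepModulus (ξ m : ℝ) : Prop :=
  m ∈ Ioo (0 : ℝ) 1 ∧ modulusIntegral ξ m = 0

/-- The Gurevich-Pitaevskii characteristic speed `v₂(m)` of the step. -/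
def gpSpeed (m : ℝ) : ℝ :=
  2 * (1 + m) - 4 * m * (1 - m) * ellipticK m / (ellipticE m - (1 - m) * ellipticK m)

/-- The integrand of the leading order phase function. -/
def istBIntegrand (ξ m s : ℝ) : ℝ :=
  (ξ + (1 - m) / 2 - s ^ 2) * Real.sqrt ((s ^ 2 - m) / (1 - s ^ 2))

/-- The leading order phase function `B`, at a given value `m` of the elliptic parameter. -/
def istB (ξ m : ℝ) : ℝ :=
  24 * ∫ s in (Real.sqrt m)..(1 : ℝ), istBIntegrand ξ m s

/-- The integrand of the phase shift. -/
def istDeltaIntegrand (m s : ℝ) : ℝ :=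
  Real.log (4 * s * Real.sqrt (1 - s ^ 2)) / Real.sqrt ((1 - s ^ 2) * (s ^ 2 - m))

/-- The phase shift `Δ`, at a given value `m` of the elliptic parameter. -/
def istDelta (m : ℝ) : ℝ :=
  1 / ellipticK m * ∫ s in (Real.sqrt m)..(1 : ℝ), istDeltaIntegrand m s

/-- The leading part `t B(ξ) / (2 π ε)` of the phase, with `ξ = x / (12 t)`. -/
def istLeadingPhase (ε x t m : ℝ) : ℝ :=
  t * istB (x / (12 * t)) m / (2 * Real.pi * ε)

/-- The order one part `Δ(ξ) / (2 π) + σ / 2` of the phase, where `σ` is the sign in `± 1 / 2`. -/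
def istPhaseShift (σ m : ℝ) : ℝ :=
  istDelta m / (2 * Real.pi) + σ / 2

/-- The total phase obtained from the inverse scattering transform. -/
def istTotalPhase (σ ε x t m : ℝ) : ℝ :=
  t * istB (x / (12 * t)) m / (2 * Real.pi * ε) + istDelta m / (2 * Real.pi) + σ / 2

/-- The fast phase `-(r₃ - r₁) ^ (3 / 2) t / (ε K'(m))` of Whitham theory, for the Riemann
invariants `r₁ = 0`, `r₂ = m`, `r₃ = 1` of the step; `K'` is the derivative of `K` in `m`. -/
def whithamFastPhase (ε t m : ℝ) : ℝ :=
  -(t / (ε * deriv ellipticK m))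

end

/-!
The equation for the parameter and the leading phase reduce to complete elliptic integrals. With
`s = √m sin φ`, the equation becomes a relation between `K(m)` and `E(m)`
(`modulusIntegral_eq`), which is linear in `ξ` and is the Gurevich-Pitaevskii equation. With
`s = √(1 - (1 - m) sin² φ)`, the function `B` becomes the same expression in `K(1 - m)` and
`E(1 - m)` (`istB_integral`); after elimination of `ξ`, Legendre's relation `legendre_relation`
collapses it to `-4 π m (1 - m) / (E - (1 - m) K)`, and the derivative of `K` is
`(E - (1 - m) K) / (2 m (1 - m))`.

Existence of the parameter follows from the limits `-6` and `4` of the speed at the ends of `(0, 1)`.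
For uniqueness, the equation prescribes the mean of `sin² φ` against the weight
`cos² φ / √(1 - m sin² φ)` as `(ξ + 1/2) / m - 1/2`, which decreases in `m`, while the mean itself
increases by a Chebyshev-type comparison (`modulusIntegral_zero_unique`).

The substitution for `B` turns the shift into `∫ log (4 √(1 - m) dn sn)` over a quarter period of
parameter `1 - m`. The integral of `log dn` follows from the symmetry `s ↦ √m / s`
(`integral_log_dn`). The integral of `log sn` is the substantial one (`weightedK_log_sin`): the
functions `∫ log (sin φ) / √(1 - m sin² φ)` and `∫ log (sin φ) √(1 - m sin² φ)` satisfy the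
differential system of `K` and `E` with an inhomogeneity that is again made of `K` and `E`, so a
Wronskian is explicitly known (`log_sin_relation`). Together with Legendre's relation it shows that
the difference of the two sides of the claimed value is a constant multiple of `K`. As `m → 1` the
difference stays bounded and `K` does not, so the constant is zero.
-/

/-! ### Weighted elliptic integrals and their derivatives -/

/-- The complete elliptic integral of the first kind with an extra weight `g` in the integrand;
`g = 1` gives `ellipticK`. -/
noncomputable def weightedK (g : ℝ → ℝ) (m : ℝ) : ℝ :=
  ∫ φ in (0 : ℝ)..(Real.pi / 2), g φ / Real.sqrt (1 - m * Real.sin φ ^ 2)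

/-- The complete elliptic integral of the second kind with an extra weight `g` in the integrand;
`g = 1` gives `ellipticE`. -/
noncomputable def weightedE (g : ℝ → ℝ) (m : ℝ) : ℝ :=
  ∫ φ in (0 : ℝ)..(Real.pi / 2), g φ * Real.sqrt (1 - m * Real.sin φ ^ 2)

theorem ellipticK_eq_weightedK : ellipticK = weightedK (fun _ => 1) := rfl

theorem ellipticE_eq_weightedE : ellipticE = weightedE (fun _ => 1) := by
  funext m
  simp [ellipticE, weightedE]

theorem one_sub_mul_sin_sq_pos {m : ℝ} (hm : m < 1) (φ : ℝ) : 0 < 1 - m * Real.sin φ ^ 2 := by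
  rcases le_or_gt m 0 with h | h <;> nlinarith [Real.sin_sq_le_one φ, sq_nonneg (Real.sin φ)]

theorem sqrt_one_sub_mul_sin_sq_pos {m : ℝ} (hm : m < 1) (φ : ℝ) :
    0 < Real.sqrt (1 - m * Real.sin φ ^ 2) :=
  Real.sqrt_pos.2 (one_sub_mul_sin_sq_pos hm φ)

theorem sq_sqrt_one_sub_mul_sin_sq {m : ℝ} (hm : m < 1) (φ : ℝ) :
    Real.sqrt (1 - m * Real.sin φ ^ 2) ^ 2 = 1 - m * Real.sin φ ^ 2 :=
  Real.sq_sqrt (one_sub_mul_sin_sq_pos hm φ).le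

theorem continuous_sqrt_one_sub_mul_sin_sq (m : ℝ) :
    Continuous fun φ : ℝ => Real.sqrt (1 - m * Real.sin φ ^ 2) := by
  fun_prop

theorem continuous_inv_sqrt_one_sub_mul_sin_sq {m : ℝ} (hm : m < 1) :
    Continuous fun φ : ℝ => (Real.sqrt (1 - m * Real.sin φ ^ 2))⁻¹ :=
  (continuous_sqrt_one_sub_mul_sin_sq m).inv₀ fun φ => (sqrt_one_sub_mul_sin_sq_pos hm φ).ne'

theorem IntervalIntegrable.div_sqrt_one_sub_mul_sin_sq {g : ℝ → ℝ} {a b m : ℝ}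
    (hg : IntervalIntegrable g volume a b) (hm : m < 1) :
    IntervalIntegrable (fun φ => g φ / Real.sqrt (1 - m * Real.sin φ ^ 2)) volume a b := by
  simpa only [div_eq_mul_inv] using
    hg.mul_continuousOn (continuous_inv_sqrt_one_sub_mul_sin_sq hm).continuousOn

theorem IntervalIntegrable.mul_sqrt_one_sub_mul_sin_sq {g : ℝ → ℝ} {a b : ℝ}
    (hg : IntervalIntegrable g volume a b) (m : ℝ) :
    IntervalIntegrable (fun φ => g φ * Real.sqrt (1 - m * Real.sin φ ^ 2)) volume a b :=
  hg.mul_continuousOn (continuous_sqrt_one_sub_mul_sin_sq m).continuousOn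

theorem hasDerivAt_sqrt_one_sub_mul_sin_sq_parameter {m : ℝ} (hm : m < 1) (φ : ℝ) :
    HasDerivAt (fun m => Real.sqrt (1 - m * Real.sin φ ^ 2))
      (-(Real.sin φ ^ 2 / (2 * Real.sqrt (1 - m * Real.sin φ ^ 2)))) m := by
  have h : HasDerivAt (fun m : ℝ => 1 - m * Real.sin φ ^ 2) (-(Real.sin φ ^ 2)) m := by
    simpa using ((hasDerivAt_id m).mul_const (Real.sin φ ^ 2)).const_sub 1
  convert h.sqrt (one_sub_mul_sin_sq_pos hm φ).ne' using 1
  ring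

/-- Parameters near a given `m < 1` keep `1 - m sin² φ` uniformly away from zero. -/
theorem exists_uniform_lower_bound {m : ℝ} (hm : m < 1) :
    ∃ δ > 0, ∃ s ∈ nhds m, ∀ x ∈ s, x < 1 ∧
      ∀ φ : ℝ, δ ≤ Real.sqrt (1 - x * Real.sin φ ^ 2) := by
  obtain ⟨b, hb, hb1⟩ := exists_between (max_lt hm one_pos)
  refine ⟨Real.sqrt (1 - b), Real.sqrt_pos.2 (by linarith), Iio b,
    Iio_mem_nhds (lt_of_le_of_lt (le_max_left _ _) hb), fun x hx => ⟨lt_trans hx hb1, fun φ => ?_⟩⟩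
  have hb0 : 0 < b := lt_of_le_of_lt (le_max_right _ _) hb
  have hx : x < b := hx
  apply Real.sqrt_le_sqrt
  nlinarith [Real.sin_sq_le_one φ, sq_nonneg (Real.sin φ)]

theorem hasDerivAt_weightedE {g : ℝ → ℝ}
    (hg : IntervalIntegrable g volume 0 (Real.pi / 2)) {m : ℝ} (hm : m < 1) :
    HasDerivAt (weightedE g)
      (∫ φ in (0 : ℝ)..(Real.pi / 2),
        g φ * -(Real.sin φ ^ 2 / (2 * Real.sqrt (1 - m * Real.sin φ ^ 2)))) m := by
  obtain ⟨δ, hδ, s, hs, hsδ⟩ := exists_uniform_lower_bound hm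
  have hc : Continuous fun φ : ℝ =>
      -(Real.sin φ ^ 2 / (2 * Real.sqrt (1 - m * Real.sin φ ^ 2))) := by
    refine (Continuous.div (by fun_prop) (by fun_prop) fun φ => ?_).neg
    have := sqrt_one_sub_mul_sin_sq_pos hm φ
    positivity
  refine (hasDerivAt_integral_of_dominated_loc_of_deriv_le (bound := fun φ => |g φ| * (1 / (2 * δ)))
    (F' := fun m φ => g φ * -(Real.sin φ ^ 2 / (2 * Real.sqrt (1 - m * Real.sin φ ^ 2))))
    hs (Filter.Eventually.of_forall fun x =>
      ((hg.mul_sqrt_one_sub_mul_sin_sq x).def'.aestronglyMeasurable))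
    (hg.mul_sqrt_one_sub_mul_sin_sq m)
    (hg.mul_continuousOn hc.continuousOn).def'.aestronglyMeasurable
    (Filter.Eventually.of_forall fun φ _ x hx => ?_) (hg.abs.mul_const _)
    (Filter.Eventually.of_forall fun φ _ x hx => ?_)).2
  · obtain ⟨_, h⟩ := hsδ x hx
    have h := h φ
    rw [norm_mul, Real.norm_eq_abs, norm_neg, Real.norm_of_nonneg (by positivity)]
    gcongr
    exact Real.sin_sq_le_one φ
  · exact (hasDerivAt_sqrt_one_sub_mul_sin_sq_parameter (hsδ x hx).1 φ).const_mul _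

theorem hasDerivAt_weightedK {g : ℝ → ℝ}
    (hg : IntervalIntegrable g volume 0 (Real.pi / 2)) {m : ℝ} (hm : m < 1) :
    HasDerivAt (weightedK g)
      (∫ φ in (0 : ℝ)..(Real.pi / 2),
        g φ * (Real.sin φ ^ 2 / (2 * Real.sqrt (1 - m * Real.sin φ ^ 2) ^ 3))) m := by
  obtain ⟨δ, hδ, s, hs, hsδ⟩ := exists_uniform_lower_bound hm
  have hc : Continuous fun φ : ℝ =>
      (Real.sin φ ^ 2 / (2 * Real.sqrt (1 - m * Real.sin φ ^ 2) ^ 3)) := by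
    refine Continuous.div (by fun_prop) (by fun_prop) fun φ => ?_
    have := sqrt_one_sub_mul_sin_sq_pos hm φ
    positivity
  have hm' := Iio_mem_nhds hm
  refine (hasDerivAt_integral_of_dominated_loc_of_deriv_le
    (bound := fun φ => |g φ| * (1 / (2 * δ ^ 3)))
    (F' := fun m φ => g φ * (Real.sin φ ^ 2 / (2 * Real.sqrt (1 - m * Real.sin φ ^ 2) ^ 3)))
    hs (Filter.mem_of_superset hm' fun x hx =>
      ((hg.div_sqrt_one_sub_mul_sin_sq hx).def'.aestronglyMeasurable))
    (hg.div_sqrt_one_sub_mul_sin_sq hm)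
    (hg.mul_continuousOn hc.continuousOn).def'.aestronglyMeasurable
    (Filter.Eventually.of_forall fun φ _ x hx => ?_) (hg.abs.mul_const _)
    (Filter.Eventually.of_forall fun φ _ x hx => ?_)).2
  · obtain ⟨_, h⟩ := hsδ x hx
    have h := h φ
    rw [norm_mul, Real.norm_eq_abs, Real.norm_of_nonneg (by positivity)]
    gcongr
    exact Real.sin_sq_le_one φ
  · have hp := sqrt_one_sub_mul_sin_sq_pos (hsδ x hx).1 φ
    have h := ((hasDerivAt_sqrt_one_sub_mul_sin_sq_parameter (hsδ x hx).1 φ).fun_inv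
      hp.ne').const_mul (g φ)
    simp only [← div_eq_mul_inv] at h
    refine h.congr_deriv ?_
    generalize Real.sqrt (1 - x * Real.sin φ ^ 2) = D at *
    field_simp

/-- The derivative of `sin φ cos φ / √(1 - m sin² φ)` in `φ`, written through powers of the
square root. -/
theorem hasDerivAt_sin_mul_cos_div_sqrt {m : ℝ} (hm : m < 1) (φ : ℝ) :
    HasDerivAt (fun φ => m * (Real.sin φ * Real.cos φ / Real.sqrt (1 - m * Real.sin φ ^ 2)))
      (Real.sqrt (1 - m * Real.sin φ ^ 2) -
        (1 - m) / Real.sqrt (1 - m * Real.sin φ ^ 2) ^ 3) φ := by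
  have hp := sqrt_one_sub_mul_sin_sq_pos hm φ
  have hsq := sq_sqrt_one_sub_mul_sin_sq hm φ
  have h1 : HasDerivAt (fun φ : ℝ => 1 - m * Real.sin φ ^ 2)
      (-(m * (2 * Real.sin φ * Real.cos φ))) φ := by
    simpa using (((Real.hasDerivAt_sin φ).pow 2).const_mul m).const_sub 1
  have h2 := h1.sqrt (one_sub_mul_sin_sq_pos hm φ).ne'
  have h3 := (((Real.hasDerivAt_sin φ).fun_mul (Real.hasDerivAt_cos φ)).fun_div h2
    hp.ne').const_mul m
  refine h3.congr_deriv ?_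
  set D := Real.sqrt (1 - m * Real.sin φ ^ 2)
  have hcos := Real.cos_sq' φ
  field_simp
  have h4 : D ^ 4 = (1 - m * Real.sin φ ^ 2) ^ 2 := by rw [← hsq]; ring
  rw [h4, hsq, hcos]
  ring

theorem continuous_sqrt_sub_div_sqrt_pow {m : ℝ} (hm : m < 1) :
    Continuous fun φ : ℝ => Real.sqrt (1 - m * Real.sin φ ^ 2) -
        (1 - m) / Real.sqrt (1 - m * Real.sin φ ^ 2) ^ 3 := by
  refine Continuous.sub (by fun_prop) (Continuous.div (by fun_prop) (by fun_prop) fun φ => ?_)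
  have := sqrt_one_sub_mul_sin_sq_pos hm φ
  positivity

theorem hasDerivAt_weightedE_eq {g : ℝ → ℝ}
    (hg : IntervalIntegrable g volume 0 (Real.pi / 2)) {m : ℝ} (hm : m < 1) (hm0 : m ≠ 0) :
    HasDerivAt (weightedE g) ((weightedE g m - weightedK g m) / (2 * m)) m := by
  refine (hasDerivAt_weightedE hg hm).congr_deriv ?_
  rw [weightedE, weightedK, ← integral_sub (hg.mul_sqrt_one_sub_mul_sin_sq m)
    (hg.div_sqrt_one_sub_mul_sin_sq hm), ← intervalIntegral.integral_div]
  refine integral_congr fun φ _ => ?_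
  have hp := sqrt_one_sub_mul_sin_sq_pos hm φ
  have hsq := sq_sqrt_one_sub_mul_sin_sq hm φ
  generalize Real.sqrt (1 - m * Real.sin φ ^ 2) = D at *
  field_simp
  linear_combination -g φ * hsq

/-- The derivative of the weighted first integral, up to the boundary contribution
`∫ g d(sin φ cos φ / √(1 - m sin² φ))`, which depends on the weight. -/
theorem hasDerivAt_weightedK_eq {g : ℝ → ℝ}
    (hg : IntervalIntegrable g volume 0 (Real.pi / 2)) {m : ℝ} (hm : m < 1) (hm0 : m ≠ 0) :
    HasDerivAt (weightedK g)
      ((weightedE g m - (1 - m) * weightedK g m - ∫ φ in (0 : ℝ)..(Real.pi / 2),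
        g φ * (Real.sqrt (1 - m * Real.sin φ ^ 2) -
          (1 - m) / Real.sqrt (1 - m * Real.sin φ ^ 2) ^ 3)) / (2 * m * (1 - m))) m := by
  refine (hasDerivAt_weightedK hg hm).congr_deriv ?_
  rw [weightedE, weightedK, ← intervalIntegral.integral_const_mul,
    ← integral_sub (hg.mul_sqrt_one_sub_mul_sin_sq m)
      ((hg.div_sqrt_one_sub_mul_sin_sq hm).const_mul _),
    ← integral_sub ((hg.mul_sqrt_one_sub_mul_sin_sq m).sub
      ((hg.div_sqrt_one_sub_mul_sin_sq hm).const_mul _))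
      (hg.mul_continuousOn (continuous_sqrt_sub_div_sqrt_pow hm).continuousOn),
    ← intervalIntegral.integral_div]
  refine integral_congr fun φ _ => ?_
  have hp := sqrt_one_sub_mul_sin_sq_pos hm φ
  have hsq := sq_sqrt_one_sub_mul_sin_sq hm φ
  have h1 : 1 - m ≠ 0 := by linarith
  generalize Real.sqrt (1 - m * Real.sin φ ^ 2) = D at *
  field_simp
  linear_combination g φ * (1 - m) * hsq

theorem integral_sqrt_sub_div_sqrt_pow {m : ℝ} (hm : m < 1) :
    ∫ φ in (0 : ℝ)..(Real.pi / 2), (Real.sqrt (1 - m * Real.sin φ ^ 2) -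
          (1 - m) / Real.sqrt (1 - m * Real.sin φ ^ 2) ^ 3) = 0 := by
  rw [integral_eq_sub_of_hasDerivAt (fun φ _ => hasDerivAt_sin_mul_cos_div_sqrt hm φ)
    ((continuous_sqrt_sub_div_sqrt_pow hm).intervalIntegrable _ _)]
  simp

theorem intervalIntegrable_log_sin_half_pi :
    IntervalIntegrable (fun φ => Real.log (Real.sin φ)) volume 0 (Real.pi / 2) :=
  intervalIntegrable_log_sin

/-- Integration by parts; `log (sin φ) sin φ` is continuous at `0` with the value zero. -/
theorem integral_log_sin_mul_sqrt_sub_div_sqrt_pow {m : ℝ} (hm : m < 1) :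
    ∫ φ in (0 : ℝ)..(Real.pi / 2), Real.log (Real.sin φ) * (Real.sqrt (1 - m * Real.sin φ ^ 2) -
          (1 - m) / Real.sqrt (1 - m * Real.sin φ ^ 2) ^ 3) =
      -∫ φ in (0 : ℝ)..(Real.pi / 2),
        m * (Real.cos φ ^ 2 / Real.sqrt (1 - m * Real.sin φ ^ 2)) := by
  have hpi := Real.pi_pos
  have hc : Continuous fun φ : ℝ => m * (Real.cos φ ^ 2 / Real.sqrt (1 - m * Real.sin φ ^ 2)) :=
    continuous_const.mul (Continuous.div (by fun_prop) (by fun_prop)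
      fun φ => (sqrt_one_sub_mul_sin_sq_pos hm φ).ne')
  have hi := intervalIntegrable_log_sin_half_pi.mul_continuousOn
    (continuous_sqrt_sub_div_sqrt_pow hm).continuousOn
  have hj := hc.intervalIntegrable (μ := volume) 0 (Real.pi / 2)
  have hcl : Continuous fun φ : ℝ => (Real.sin φ * Real.log (Real.sin φ)) *
      (m * (Real.cos φ / Real.sqrt (1 - m * Real.sin φ ^ 2))) :=
    (Real.continuous_mul_log.comp Real.continuous_sin).mul
      (continuous_const.mul (Continuous.div (by fun_prop) (by fun_prop)
        fun φ => (sqrt_one_sub_mul_sin_sq_pos hm φ).ne'))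
  have key := integral_eq_sub_of_hasDerivAt_of_le (a := 0) (b := Real.pi / 2) (by positivity)
    (f := fun φ => (Real.sin φ * Real.log (Real.sin φ)) *
      (m * (Real.cos φ / Real.sqrt (1 - m * Real.sin φ ^ 2))))
    (f' := fun φ => Real.log (Real.sin φ) * (Real.sqrt (1 - m * Real.sin φ ^ 2) -
          (1 - m) / Real.sqrt (1 - m * Real.sin φ ^ 2) ^ 3) +
          m * (Real.cos φ ^ 2 / Real.sqrt (1 - m * Real.sin φ ^ 2)))
    hcl.continuousOn (fun φ hφ => ?_) (hi.add hj)
  · rw [integral_add hi hj] at key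
    simp only [Real.sin_zero, Real.cos_pi_div_two, zero_mul, zero_div, mul_zero, sub_zero] at key
    linarith
  · have hs : 0 < Real.sin φ := Real.sin_pos_of_pos_of_lt_pi hφ.1 (by linarith [hφ.2])
    have hp := sqrt_one_sub_mul_sin_sq_pos hm φ
    have h := ((Real.hasDerivAt_sin φ).log hs.ne').fun_mul (hasDerivAt_sin_mul_cos_div_sqrt hm φ)
    have heq : (fun φ => (Real.sin φ * Real.log (Real.sin φ)) *
        (m * (Real.cos φ / Real.sqrt (1 - m * Real.sin φ ^ 2)))) = fun φ => Real.log (Real.sin φ) *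
        (m * (Real.sin φ * Real.cos φ / Real.sqrt (1 - m * Real.sin φ ^ 2))) := by
      funext y
      ring
    rw [heq]
    refine h.congr_deriv ?_
    field_simp
    ring

/-! ### The derivatives of the complete elliptic integrals -/

theorem integral_mul_cos_sq_div_sqrt {m : ℝ} (hm : m < 1) :
    ∫ φ in (0 : ℝ)..(Real.pi / 2), m * (Real.cos φ ^ 2 / Real.sqrt (1 - m * Real.sin φ ^ 2)) =
      ellipticE m - (1 - m) * ellipticK m := by
  have h1 : IntervalIntegrable (fun φ => 1 / Real.sqrt (1 - m * Real.sin φ ^ 2)) volume 0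
      (Real.pi / 2) := (intervalIntegrable_const (c := (1 : ℝ))).div_sqrt_one_sub_mul_sin_sq hm
  rw [ellipticE, ellipticK, ← intervalIntegral.integral_const_mul, ← integral_sub
    ((continuous_sqrt_one_sub_mul_sin_sq m).intervalIntegrable _ _) (h1.const_mul _)]
  refine integral_congr fun φ _ => ?_
  have hp := sqrt_one_sub_mul_sin_sq_pos hm φ
  have hsq := sq_sqrt_one_sub_mul_sin_sq hm φ
  generalize Real.sqrt (1 - m * Real.sin φ ^ 2) = D at *
  simp only [Real.cos_sq']
  field_simp
  linear_combination -hsq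

theorem ellipticE_sub_pos {m : ℝ} (hm : m ∈ Ioo (0 : ℝ) 1) :
    0 < ellipticE m - (1 - m) * ellipticK m := by
  have hpi := Real.pi_pos
  have hc : Continuous fun φ : ℝ => m * (Real.cos φ ^ 2 / Real.sqrt (1 - m * Real.sin φ ^ 2)) :=
    continuous_const.mul (Continuous.div (by fun_prop) (by fun_prop)
      fun φ => (sqrt_one_sub_mul_sin_sq_pos hm.2 φ).ne')
  rw [← integral_mul_cos_sq_div_sqrt hm.2]
  refine intervalIntegral_pos_of_pos_on (hc.intervalIntegrable _ _) (fun φ hφ => ?_) (by positivity)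
  have h1 := Real.cos_pos_of_mem_Ioo (x := φ) ⟨by linarith [hφ.1], hφ.2⟩
  have h2 := sqrt_one_sub_mul_sin_sq_pos hm.2 φ
  have h3 := hm.1
  positivity

theorem ellipticK_pos {m : ℝ} (hm : m < 1) : 0 < ellipticK m := by
  have hpi := Real.pi_pos
  refine intervalIntegral_pos_of_pos_on
    ((intervalIntegrable_const (c := (1 : ℝ))).div_sqrt_one_sub_mul_sin_sq hm) (fun φ _ => ?_)
    (by positivity)
  have h2 := sqrt_one_sub_mul_sin_sq_pos hm φ
  positivity

theorem hasDerivAt_ellipticK {m : ℝ} (hm : m < 1) (hm0 : m ≠ 0) :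
    HasDerivAt ellipticK
      ((ellipticE m - (1 - m) * ellipticK m) / (2 * m * (1 - m))) m := by
  have h := hasDerivAt_weightedK_eq (g := fun _ => 1) intervalIntegrable_const hm hm0
  simp only [one_mul] at h
  rwa [integral_sqrt_sub_div_sqrt_pow hm, sub_zero, ← ellipticK_eq_weightedK,
    ← ellipticE_eq_weightedE] at h

theorem hasDerivAt_ellipticE {m : ℝ} (hm : m < 1) (hm0 : m ≠ 0) :
    HasDerivAt ellipticE ((ellipticE m - ellipticK m) / (2 * m)) m := by
  simpa only [← ellipticK_eq_weightedK, ← ellipticE_eq_weightedE] using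
    hasDerivAt_weightedE_eq (g := fun _ => 1) intervalIntegrable_const hm hm0

theorem hasDerivAt_ellipticK_one_sub {m : ℝ} (hm : m ∈ Ioo (0 : ℝ) 1) :
    HasDerivAt (fun m => ellipticK (1 - m))
      (-((ellipticE (1 - m) - m * ellipticK (1 - m)) / (2 * m * (1 - m)))) m := by
  have h := (hasDerivAt_ellipticK (m := 1 - m) (by linarith [hm.1])
    (by linarith [hm.2])).comp_const_sub 1 m
  rw [sub_sub_cancel] at h
  exact h.congr_deriv (by ring)

theorem hasDerivAt_ellipticE_one_sub {m : ℝ} (hm : m ∈ Ioo (0 : ℝ) 1) :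
    HasDerivAt (fun m => ellipticE (1 - m))
      (-((ellipticE (1 - m) - ellipticK (1 - m)) / (2 * (1 - m)))) m :=
  (hasDerivAt_ellipticE (m := 1 - m) (by linarith [hm.1]) (by linarith [hm.2])).comp_const_sub 1 m

theorem hasDerivAt_weightedK_log_sin {m : ℝ} (hm : m < 1) (hm0 : m ≠ 0) :
    HasDerivAt (weightedK fun φ => Real.log (Real.sin φ))
      ((weightedE (fun φ => Real.log (Real.sin φ)) m -
        (1 - m) * weightedK (fun φ => Real.log (Real.sin φ)) m +
        (ellipticE m - (1 - m) * ellipticK m)) / (2 * m * (1 - m))) m := by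
  have h := hasDerivAt_weightedK_eq intervalIntegrable_log_sin_half_pi hm hm0
  rwa [integral_log_sin_mul_sqrt_sub_div_sqrt_pow hm, integral_mul_cos_sq_div_sqrt hm,
    sub_neg_eq_add] at h

/-! ### Limits and bounds at the ends of the parameter interval -/

theorem continuous_ellipticE : Continuous ellipticE :=
  continuous_parametric_intervalIntegral_of_continuous'
    (f := fun m φ => Real.sqrt (1 - m * Real.sin φ ^ 2)) (by fun_prop) _ _

theorem ellipticE_one : ellipticE 1 = 1 := by
  have hpi := Real.pi_pos
  have h : ellipticE 1 = ∫ φ in (0 : ℝ)..(Real.pi / 2), Real.cos φ := by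
    refine integral_congr fun φ hφ => ?_
    rw [uIcc_of_le (by positivity)] at hφ
    simp only [one_mul]
    rw [← Real.cos_sq', Real.sqrt_sq (Real.cos_nonneg_of_mem_Icc ⟨by linarith [hφ.1], hφ.2⟩)]
  simp [h]

theorem ellipticK_zero : ellipticK 0 = Real.pi / 2 := by simp [ellipticK]

theorem ellipticE_zero : ellipticE 0 = Real.pi / 2 := by simp [ellipticE]

theorem differentiableAt_ellipticK {m : ℝ} (hm : m < 1) : DifferentiableAt ℝ ellipticK m :=
  (hasDerivAt_weightedK (g := fun _ => 1) intervalIntegrable_const hm).differentiableAt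

theorem ellipticK_le {m : ℝ} (hm : m < 1) (hm0 : 0 ≤ m) :
    ellipticK m ≤ Real.pi / 2 / Real.sqrt (1 - m) := by
  have hpi := Real.pi_pos
  have h : ellipticK m ≤ ∫ φ in (0 : ℝ)..(Real.pi / 2), 1 / Real.sqrt (1 - m) := by
    refine integral_mono_on (by positivity)
      ((intervalIntegrable_const (c := (1 : ℝ))).div_sqrt_one_sub_mul_sin_sq hm)
      intervalIntegrable_const fun φ _ => ?_
    have h1 : 0 < Real.sqrt (1 - m) := Real.sqrt_pos.2 (by linarith)
    gcongr
    nlinarith [Real.sin_sq_le_one φ]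
  refine h.trans_eq ?_
  rw [intervalIntegral.integral_const]
  simp [div_eq_mul_inv]

/-- The logarithmic divergence of `K` at `m = 1`, from `1 - m sin² φ ≤ (√(1 - m) + π/2 - φ)²`. -/
theorem neg_log_le_ellipticK {m : ℝ} (hm : m < 1) :
    -Real.log (Real.sqrt (1 - m)) ≤ ellipticK m := by
  have hpi := Real.pi_pos
  have ha : 0 < Real.sqrt (1 - m) := Real.sqrt_pos.2 (by linarith)
  have hasq : Real.sqrt (1 - m) ^ 2 = 1 - m := Real.sq_sqrt (by linarith)
  set a := Real.sqrt (1 - m)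
  have hpos : ∀ φ ∈ Icc 0 (Real.pi / 2), 0 < a + Real.pi / 2 - φ := fun φ hφ => by linarith [hφ.2]
  have hI : IntervalIntegrable (fun φ => 1 / (a + Real.pi / 2 - φ)) volume 0 (Real.pi / 2) := by
    refine ContinuousOn.intervalIntegrable ?_
    rw [uIcc_of_le (by positivity)]
    exact ContinuousOn.div (by fun_prop) (by fun_prop) fun φ hφ => (hpos φ hφ).ne'
  have hval : ∫ φ in (0 : ℝ)..(Real.pi / 2), 1 / (a + Real.pi / 2 - φ) =
      Real.log (a + Real.pi / 2) - Real.log a := by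
    rw [integral_eq_sub_of_hasDerivAt (f := fun φ => -Real.log (a + Real.pi / 2 - φ))
      (fun φ hφ => ?_) hI]
    · simp only [sub_zero, add_sub_cancel_right]
      ring
    · rw [uIcc_of_le (by positivity)] at hφ
      refine ((((hasDerivAt_id φ).const_sub (a + Real.pi / 2)).log (hpos φ hφ).ne').neg).congr_deriv ?_
      simp [neg_div]
  have hle : ∫ φ in (0 : ℝ)..(Real.pi / 2), 1 / (a + Real.pi / 2 - φ) ≤ ellipticK m := by
    refine integral_mono_on (by positivity) hI
      ((intervalIntegrable_const (c := (1 : ℝ))).div_sqrt_one_sub_mul_sin_sq hm) fun φ hφ => ?_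
    have h1 := hpos φ hφ
    have h2 := sqrt_one_sub_mul_sin_sq_pos hm φ
    have h3 : Real.sqrt (1 - m * Real.sin φ ^ 2) ≤ a + Real.pi / 2 - φ := by
      refine Real.sqrt_le_iff.2 ⟨h1.le, ?_⟩
      have hc0 : 0 ≤ Real.cos φ := Real.cos_nonneg_of_mem_Icc ⟨by linarith [hφ.1], hφ.2⟩
      have hc1 : Real.cos φ ≤ Real.pi / 2 - φ := by
        rw [← Real.sin_pi_div_two_sub]
        exact Real.sin_le (by linarith [hφ.2])
      have hsc := Real.sin_sq φ
      have hc2 : Real.cos φ ^ 2 ≤ (Real.pi / 2 - φ) ^ 2 := by gcongr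
      nlinarith [mul_nonneg ha.le (hc0.trans hc1), sq_nonneg (Real.cos φ)]
    gcongr
  have hlog : 0 ≤ Real.log (a + Real.pi / 2) :=
    Real.log_nonneg (by linarith [Real.pi_gt_three])
  linarith

theorem ellipticK_sub_ellipticE_mem {m : ℝ} (hm : m < 1) (hm0 : 0 ≤ m) :
    0 ≤ ellipticK m - ellipticE m ∧ ellipticK m - ellipticE m ≤ m * ellipticK m := by
  have hpi := Real.pi_pos
  have h1 : IntervalIntegrable (fun φ => 1 / Real.sqrt (1 - m * Real.sin φ ^ 2)) volume 0
      (Real.pi / 2) := (intervalIntegrable_const (c := (1 : ℝ))).div_sqrt_one_sub_mul_sin_sq hm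
  have h2 := (continuous_sqrt_one_sub_mul_sin_sq m).intervalIntegrable (μ := volume) 0 (Real.pi / 2)
  constructor
  · rw [sub_nonneg]
    refine integral_mono_on (by positivity) h2 h1 fun φ _ => ?_
    have hp := sqrt_one_sub_mul_sin_sq_pos hm φ
    rw [le_div_iff₀ hp, ← sq, sq_sqrt_one_sub_mul_sin_sq hm φ]
    nlinarith [sq_nonneg (Real.sin φ)]
  · have : (1 - m) * ellipticK m ≤ ellipticE m := by
      rw [ellipticK, ← intervalIntegral.integral_const_mul]
      refine integral_mono_on (by positivity) (h1.const_mul _) h2 fun φ _ => ?_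
      have hp := sqrt_one_sub_mul_sin_sq_pos hm φ
      rw [mul_one_div, div_le_iff₀ hp, ← sq, sq_sqrt_one_sub_mul_sin_sq hm φ]
      nlinarith [Real.sin_sq_le_one φ]
    linarith

theorem ellipticK_mul_one_sub_tendsto :
    Filter.Tendsto (fun m => (1 - m) * ellipticK m) (nhdsWithin 1 (Iio 1)) (nhds 0) := by
  have hb : Filter.Tendsto (fun m : ℝ => Real.pi / 2 * Real.sqrt (1 - m)) (nhdsWithin 1 (Iio 1))
      (nhds 0) := by
    have : Continuous fun m : ℝ => Real.pi / 2 * Real.sqrt (1 - m) := by fun_prop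
    simpa using (this.tendsto 1).mono_left nhdsWithin_le_nhds
  refine tendsto_of_tendsto_of_tendsto_of_le_of_le' tendsto_const_nhds hb ?_ ?_
  · filter_upwards [self_mem_nhdsWithin] with m hm
    exact mul_nonneg (sub_nonneg.2 (le_of_lt hm)) (ellipticK_pos hm).le
  · filter_upwards [Ioo_mem_nhdsLT (show (0 : ℝ) < 1 by norm_num)] with m hm
    have h1 : 0 < 1 - m := by linarith [hm.2]
    have hs := Real.sqrt_pos.2 h1
    calc (1 - m) * ellipticK m ≤ (1 - m) * (Real.pi / 2 / Real.sqrt (1 - m)) := by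
          gcongr
          exact ellipticK_le hm.2 hm.1.le
      _ = Real.pi / 2 * Real.sqrt (1 - m) := by
          nth_rewrite 1 [← Real.sq_sqrt h1.le]
          field_simp

theorem tendsto_one_sub_nhdsWithin :
    Filter.Tendsto (fun m : ℝ => 1 - m) (nhdsWithin 0 (Ioi 0)) (nhdsWithin 1 (Iio 1)) := by
  refine tendsto_nhdsWithin_of_tendsto_nhds_of_eventually_within _ ?_ ?_
  · have : Continuous fun m : ℝ => 1 - m := by fun_prop
    simpa using (this.tendsto 0).mono_left nhdsWithin_le_nhds
  · filter_upwards [self_mem_nhdsWithin] with m hm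
    have : 0 < m := hm
    simpa using this

/-! ### Legendre's relation -/

/-- A function on `(0, 1)` with vanishing derivative is constant. -/
theorem eq_of_hasDerivAt_zero_on_Ioo {f : ℝ → ℝ} (hf : ∀ m ∈ Ioo (0 : ℝ) 1, HasDerivAt f 0 m)
    {x y : ℝ} (hx : x ∈ Ioo (0 : ℝ) 1) (hy : y ∈ Ioo (0 : ℝ) 1) : f x = f y :=
  isOpen_Ioo.is_const_of_deriv_eq_zero isPreconnected_Ioo
    (fun m hm => (hf m hm).differentiableAt.differentiableWithinAt)
    (fun m hm => (hf m hm).deriv) hx hy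

/-- Legendre's relation between the complete elliptic integrals of complementary parameters. -/
theorem legendre_relation {m : ℝ} (hm : m ∈ Ioo (0 : ℝ) 1) :
    ellipticE m * ellipticK (1 - m) + ellipticE (1 - m) * ellipticK m -
      ellipticK m * ellipticK (1 - m) = Real.pi / 2 := by
  set f : ℝ → ℝ := fun m => ellipticE m * ellipticK (1 - m) + ellipticE (1 - m) * ellipticK m -
      ellipticK m * ellipticK (1 - m) with hf
  have hd : ∀ x ∈ Ioo (0 : ℝ) 1, HasDerivAt f 0 x := fun x hx => by
    have hK := hasDerivAt_ellipticK hx.2 hx.1.ne'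
    have hE := hasDerivAt_ellipticE hx.2 hx.1.ne'
    have hK' := hasDerivAt_ellipticK_one_sub hx
    have hE' := hasDerivAt_ellipticE_one_sub hx
    refine (((hE.fun_mul hK').fun_add (hE'.fun_mul hK)).fun_sub (hK.fun_mul hK')).congr_deriv ?_
    have h0 := hx.1.ne'
    have h1 : 1 - x ≠ 0 := by linarith [hx.2]
    field_simp
    ring
  have hlim : Filter.Tendsto f (nhdsWithin 0 (Ioi 0)) (nhds (Real.pi / 2)) := by
    have hK0 : Filter.Tendsto ellipticK (nhdsWithin 0 (Ioi 0)) (nhds (Real.pi / 2)) := by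
      have := (differentiableAt_ellipticK zero_lt_one).continuousAt.tendsto
      rw [ellipticK_zero] at this
      exact this.mono_left nhdsWithin_le_nhds
    have hE' : Filter.Tendsto (fun m => ellipticE (1 - m)) (nhdsWithin 0 (Ioi 0)) (nhds 1) := by
      have hc : Continuous fun m : ℝ => ellipticE (1 - m) :=
        continuous_ellipticE.comp (by fun_prop)
      simpa [ellipticE_one] using (hc.tendsto 0).mono_left nhdsWithin_le_nhds
    have hmK : Filter.Tendsto (fun m => m * ellipticK (1 - m)) (nhdsWithin 0 (Ioi 0)) (nhds 0) := by
      simpa [Function.comp_def] using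
        ellipticK_mul_one_sub_tendsto.comp tendsto_one_sub_nhdsWithin
    have hprod : Filter.Tendsto (fun m => (ellipticK m - ellipticE m) * ellipticK (1 - m))
        (nhdsWithin 0 (Ioi 0)) (nhds 0) := by
      have hb := hmK.mul hK0
      rw [zero_mul] at hb
      refine tendsto_of_tendsto_of_tendsto_of_le_of_le' tendsto_const_nhds hb ?_ ?_
      all_goals
        filter_upwards [Ioo_mem_nhdsGT (show (0 : ℝ) < 1 by norm_num)] with m hm
        have h1 := ellipticK_sub_ellipticE_mem hm.2 hm.1.le
        have h2 := ellipticK_pos (m := 1 - m) (by linarith [hm.1])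
      · exact mul_nonneg h1.1 h2.le
      · nlinarith [mul_le_mul_of_nonneg_right h1.2 h2.le]
    have h := (hE'.mul hK0).sub hprod
    rw [one_mul, sub_zero] at h
    refine h.congr fun m => ?_
    simp only [hf]
    ring
  have hconst : Filter.Tendsto f (nhdsWithin 0 (Ioi 0)) (nhds (f m)) := by
    refine tendsto_const_nhds.congr' ?_
    filter_upwards [Ioo_mem_nhdsGT (show (0 : ℝ) < 1 by norm_num)] with x hx
    exact eq_of_hasDerivAt_zero_on_Ioo hd hm hx
  exact tendsto_nhds_unique hconst hlim

/-! ### The logarithmic integral `∫ log (sn u) du` -/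

/-- A Wronskian of the pairs `(K, E)` and their `log sin`-weighted companions. It plays the role of
Legendre's relation for the logarithmic integral and is evaluated at `m = 0`. -/
theorem log_sin_relation {m : ℝ} (hm : m ∈ Ioo (0 : ℝ) 1) :
    ellipticK m * weightedE (fun φ => Real.log (Real.sin φ)) m -
      weightedK (fun φ => Real.log (Real.sin φ)) m * ellipticE m +
      ellipticK m * ellipticE m - (1 - m) * ellipticK m ^ 2 / 2 = Real.pi ^ 2 / 8 := by
  set F := weightedK fun φ => Real.log (Real.sin φ) with hF
  set G := weightedE fun φ => Real.log (Real.sin φ) with hG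
  set f : ℝ → ℝ := fun m => ellipticK m * G m - F m * ellipticE m + ellipticK m * ellipticE m -
    (1 - m) * ellipticK m ^ 2 / 2 with hf
  have hd : ∀ x ∈ Ioo (0 : ℝ) m, HasDerivAt f 0 x := fun x hx => by
    have hx1 : x < 1 := hx.2.trans hm.2
    have hK := hasDerivAt_ellipticK hx1 hx.1.ne'
    have hE := hasDerivAt_ellipticE hx1 hx.1.ne'
    have hFd := hasDerivAt_weightedK_log_sin hx1 hx.1.ne'
    have hGd := hasDerivAt_weightedE_eq intervalIntegrable_log_sin_half_pi hx1 hx.1.ne'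
    rw [← hF, ← hG] at hFd
    rw [← hF, ← hG] at hGd
    have h1d : HasDerivAt (fun m : ℝ => 1 - m) (-1) x := by
      simpa using (hasDerivAt_id x).const_sub 1
    refine (((hK.fun_mul hGd).fun_sub (hFd.fun_mul hE)).fun_add (hK.fun_mul hE)).fun_sub
      ((h1d.fun_mul (hK.fun_pow 2)).div_const 2) |>.congr_deriv ?_
    have h0 := hx.1.ne'
    have h1 : 1 - x ≠ 0 := by linarith
    field_simp
    ring
  -- the formulas for the derivatives degenerate at `0`, so the endpoint enters through continuity only
  have hc : ContinuousOn f (Icc 0 m) := by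
    intro x hx
    have hx1 : x < 1 := lt_of_le_of_lt hx.2 hm.2
    have hK := (differentiableAt_ellipticK hx1).continuousAt
    have hE := continuous_ellipticE.continuousAt (x := x)
    have hFc := (hasDerivAt_weightedK intervalIntegrable_log_sin_half_pi hx1).continuousAt
    have hGc := (hasDerivAt_weightedE intervalIntegrable_log_sin_half_pi hx1).continuousAt
    rw [← hF] at hFc
    rw [← hG] at hGc
    refine ContinuousAt.continuousWithinAt ?_
    fun_prop
  obtain ⟨c, _, h⟩ := exists_hasDerivAt_eq_slope f (fun _ => 0) hm.1 hc hd
  have hm0 : m - 0 ≠ 0 := by linarith [hm.1]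
  rw [eq_comm, div_eq_zero_iff, or_iff_left hm0, sub_eq_zero] at h
  change f m = _
  have hFG : F 0 = G 0 := by simp [hF, hG, weightedK, weightedE]
  rw [h, hf]
  simp only [ellipticK_zero, ellipticE_zero, hFG]
  ring

theorem ellipticK_log_abs_le {m : ℝ} (hm : m ∈ Ioo (1 / 2 : ℝ) 1) :
    |ellipticK m * Real.log m| ≤ Real.pi := by
  have h0 : 0 < m := by linarith [hm.1]
  have h1 : 0 < 1 - m := by linarith [hm.2]
  have hs := Real.sqrt_pos.2 h1
  have hs1 : Real.sqrt (1 - m) ≤ 1 := Real.sqrt_le_one.2 (by linarith)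
  have hK := ellipticK_pos hm.2
  rw [abs_mul, abs_of_pos hK, abs_of_nonpos (Real.log_nonpos h0.le hm.2.le)]
  have hlog : -Real.log m ≤ 2 * Real.sqrt (1 - m) ^ 2 := by
    rw [Real.sq_sqrt h1.le]
    have := Real.one_sub_inv_le_log_of_pos h0
    have h2 : m⁻¹ - 1 ≤ 2 * (1 - m) := by
      rw [sub_le_iff_le_add, inv_le_iff_one_le_mul₀ h0]
      nlinarith [hm.1]
    linarith
  calc ellipticK m * -Real.log m
      ≤ Real.pi / 2 / Real.sqrt (1 - m) * (2 * Real.sqrt (1 - m) ^ 2) := by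
        gcongr
        · exact neg_nonneg.2 (Real.log_nonpos h0.le hm.2.le)
        · exact ellipticK_le hm.2 h0.le
    _ = Real.pi * Real.sqrt (1 - m) := by field_simp
    _ ≤ Real.pi := by nlinarith [Real.pi_pos]

/-- The logarithmic integral stays bounded as `m → 1`: off the region `cos φ ≈ 0` the square root is
harmless, and there `log (sin φ)` vanishes to second order. -/
theorem weightedK_log_sin_abs_le {m : ℝ} (hm : m ∈ Ioo (0 : ℝ) 1) :
    |weightedK (fun φ => Real.log (Real.sin φ)) m| ≤
      ∫ φ in (0 : ℝ)..(Real.pi / 2), (1 / 2 - Real.log (Real.sin φ)) := by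
  have hpi := Real.pi_pos
  have hI := intervalIntegrable_log_sin_half_pi
  have hb : IntervalIntegrable (fun φ => 1 / 2 - Real.log (Real.sin φ)) volume 0 (Real.pi / 2) :=
    intervalIntegrable_const.sub hI
  rw [← Real.norm_eq_abs]
  refine norm_integral_le_of_norm_le (by positivity) (Filter.Eventually.of_forall fun φ hφ => ?_) hb
  have hs0 : 0 < Real.sin φ := Real.sin_pos_of_pos_of_lt_pi hφ.1 (by linarith [hφ.2])
  have hc0 : 0 ≤ Real.cos φ := Real.cos_nonneg_of_mem_Icc ⟨by linarith [hφ.1], hφ.2⟩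
  have hlog : Real.log (Real.sin φ) ≤ 0 := Real.log_nonpos hs0.le (Real.sin_le_one φ)
  have hp := sqrt_one_sub_mul_sin_sq_pos hm.2 φ
  have hsq := Real.sin_sq_add_cos_sq φ
  have hc1 := Real.cos_le_one φ
  have hcD : Real.cos φ ≤ Real.sqrt (1 - m * Real.sin φ ^ 2) := by
    apply Real.le_sqrt_of_sq_le
    nlinarith [sq_nonneg (Real.sin φ), hm.2]
  rw [norm_div, Real.norm_of_nonpos hlog, Real.norm_of_nonneg hp.le, div_le_iff₀ hp]
  -- `-log x ≤ 1 / x - 1` at `x = sin² φ`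
  have h1 : -Real.log (Real.sin φ) * Real.sin φ ^ 2 ≤ Real.cos φ ^ 2 / 2 := by
    have h2 := Real.one_sub_inv_le_log_of_pos (pow_pos hs0 2)
    rw [Real.log_pow] at h2
    push_cast at h2
    have h3 : (1 - (Real.sin φ ^ 2)⁻¹) * Real.sin φ ^ 2 = Real.sin φ ^ 2 - 1 := by
      field_simp
    nlinarith [mul_le_mul_of_nonneg_right h2 (sq_nonneg (Real.sin φ))]
  have h2 : Real.cos φ ^ 2 ≤ Real.sqrt (1 - m * Real.sin φ ^ 2) := by nlinarith
  have h3 : -Real.log (Real.sin φ) =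
      -Real.log (Real.sin φ) * Real.sin φ ^ 2 + -Real.log (Real.sin φ) * Real.cos φ ^ 2 := by
    rw [← mul_add, hsq, mul_one]
  nlinarith [mul_le_mul_of_nonneg_left h2 (neg_nonneg.2 hlog)]

/-- The classical value of `∫ log (sn u) du` over a quarter period. By the two Wronskian relations
the quotient of the difference of both sides by `K` is constant; it vanishes because the difference
is bounded as `m → 1`, while `K` is not. -/
theorem weightedK_log_sin {m : ℝ} (hm : m ∈ Ioo (0 : ℝ) 1) :
    weightedK (fun φ => Real.log (Real.sin φ)) m =
      -(Real.pi / 4 * ellipticK (1 - m)) - ellipticK m * Real.log m / 4 := by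
  have hpi := Real.pi_pos
  set F := weightedK fun φ => Real.log (Real.sin φ) with hF
  set D : ℝ → ℝ := fun m =>
    F m + Real.pi / 4 * ellipticK (1 - m) + ellipticK m * Real.log m / 4 with hD
  have hd : ∀ x ∈ Ioo (0 : ℝ) 1, HasDerivAt (fun m => D m / ellipticK m) 0 x := fun x hx => by
    have h0 := hx.1.ne'
    have h1 : 1 - x ≠ 0 := by linarith [hx.2]
    have hK := hasDerivAt_ellipticK hx.2 h0
    have hK' := hasDerivAt_ellipticK_one_sub hx
    have hFd := hasDerivAt_weightedK_log_sin hx.2 h0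
    rw [← hF] at hFd
    have hKp := (ellipticK_pos hx.2).ne'
    have hleg := legendre_relation hx
    have hW := log_sin_relation hx
    rw [← hF] at hW
    refine (((hFd.fun_add (hK'.const_mul (Real.pi / 4))).fun_add
      ((hK.fun_mul (Real.hasDerivAt_log h0)).div_const 4)).fun_div hK hKp).congr_deriv ?_
    rw [div_eq_zero_iff]
    left
    field_simp
    linear_combination 4 * hW - Real.pi * hleg
  obtain ⟨C, hC⟩ : ∃ C, ∀ x ∈ Ioo (0 : ℝ) 1, D x = C * ellipticK x :=
    ⟨D m / ellipticK m, fun x hx => by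
      rw [eq_of_hasDerivAt_zero_on_Ioo hd hm hx, div_mul_cancel₀ _ (ellipticK_pos hx.2).ne']⟩
  obtain ⟨M, hM⟩ : ∃ M, ∀ x ∈ Ioo (1 / 2 : ℝ) 1, |D x| ≤ M := by
    refine ⟨(∫ φ in (0 : ℝ)..(Real.pi / 2), (1 / 2 - Real.log (Real.sin φ))) +
      Real.pi / 4 * (Real.pi / 2 / Real.sqrt (1 / 2)) + Real.pi / 4, fun x hx => ?_⟩
    have h1 := weightedK_log_sin_abs_le (m := x) ⟨by linarith [hx.1], hx.2⟩
    have h2 : ellipticK (1 - x) ≤ Real.pi / 2 / Real.sqrt (1 / 2) := by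
      refine (ellipticK_le (m := 1 - x) (by linarith [hx.1]) (by linarith [hx.2])).trans ?_
      gcongr
      linarith [hx.1]
    have h3 := ellipticK_log_abs_le hx
    have h4 := ellipticK_pos (m := 1 - x) (by linarith [hx.1])
    simp only [hD]
    refine (abs_add_le _ _).trans (add_le_add ((abs_add_le _ _).trans (add_le_add h1 ?_)) ?_)
    · rw [abs_of_pos (by positivity)]
      gcongr
    · rw [abs_div, abs_of_pos (by norm_num : (0 : ℝ) < 4)]
      gcongr
  have hC0 : C = 0 := by
    by_contra hne
    have hCp : 0 < |C| := abs_pos.2 hne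
    have hM0 : 0 ≤ M := (abs_nonneg _).trans (hM (3 / 4) ⟨by norm_num, by norm_num⟩)
    -- a parameter close to `1` at which `K` exceeds `M / |C|`
    set L := M / |C| + 1 with hL
    have hL0 : 0 < L := by positivity
    set x := 1 - Real.exp (-L) ^ 2 with hx
    have he : 0 < Real.exp (-L) := Real.exp_pos _
    have he2 : Real.exp (-L) ≤ 1 / 2 := by
      rw [Real.exp_neg, inv_le_comm₀ (Real.exp_pos _) (by norm_num)]
      have := Real.add_one_le_exp L
      have : 1 ≤ L := by rw [hL]; linarith [div_nonneg hM0 hCp.le]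
      norm_num
      linarith
    have hx1 : x ∈ Ioo (1 / 2 : ℝ) 1 := ⟨by nlinarith, by nlinarith⟩
    have hKx := neg_log_le_ellipticK hx1.2
    rw [hx, sub_sub_cancel, Real.sqrt_sq he.le, Real.log_exp, neg_neg, ← hx] at hKx
    have h1 := hM x hx1
    rw [hC x ⟨by linarith [hx1.1], hx1.2⟩, abs_mul, abs_of_pos (ellipticK_pos hx1.2)] at h1
    have h2 : |C| * L ≤ M := (mul_le_mul_of_nonneg_left hKx hCp.le).trans h1
    rw [hL, mul_add, mul_div_cancel₀ _ hCp.ne'] at h2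
    linarith
  have h := hC m hm
  rw [hC0, zero_mul] at h
  simp only [hD] at h
  linarith

/-! ### The equation for the elliptic parameter -/

theorem continuous_mul_cos_sq_div_sqrt {m : ℝ} (hm : m < 1) (n : ℝ) :
    Continuous fun φ : ℝ => n * (Real.cos φ ^ 2 / Real.sqrt (1 - m * Real.sin φ ^ 2)) :=
  continuous_const.mul (Continuous.div (by fun_prop) (by fun_prop)
    fun φ => (sqrt_one_sub_mul_sin_sq_pos hm φ).ne')

theorem hasDerivAt_sin_mul_cos_mul_sqrt {m : ℝ} (hm : m < 1) (φ : ℝ) :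
    HasDerivAt (fun φ => Real.sin φ * Real.cos φ * Real.sqrt (1 - m * Real.sin φ ^ 2))
      ((1 - 2 * (1 + m) * Real.sin φ ^ 2 + 3 * m * Real.sin φ ^ 4) /
        Real.sqrt (1 - m * Real.sin φ ^ 2)) φ := by
  have hp := sqrt_one_sub_mul_sin_sq_pos hm φ
  have hsq := sq_sqrt_one_sub_mul_sin_sq hm φ
  have h1 : HasDerivAt (fun φ : ℝ => 1 - m * Real.sin φ ^ 2)
      (-(m * (2 * Real.sin φ * Real.cos φ))) φ := by
    simpa using (((Real.hasDerivAt_sin φ).pow 2).const_mul m).const_sub 1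
  have h2 := h1.sqrt (one_sub_mul_sin_sq_pos hm φ).ne'
  refine (((Real.hasDerivAt_sin φ).fun_mul (Real.hasDerivAt_cos φ)).fun_mul h2).congr_deriv ?_
  generalize Real.sqrt (1 - m * Real.sin φ ^ 2) = D at *
  have hcos := Real.cos_sq' φ
  field_simp
  rw [hsq, hcos]
  ring

/-- The reduction of the integrals occurring in the equation for the parameter and in the leading
phase to `K` and `E`, by integrating the derivative of `sin φ cos φ √(1 - m sin² φ)`. -/
theorem integral_sub_mul_sin_sq_mul_cos_sq_div_sqrt {m : ℝ} (hm : m < 1) (c : ℝ) :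
    ∫ φ in (0 : ℝ)..(Real.pi / 2), (c - m * Real.sin φ ^ 2) *
        (m * (Real.cos φ ^ 2 / Real.sqrt (1 - m * Real.sin φ ^ 2))) =
      c * (ellipticE m - (1 - m) * ellipticK m) -
        ((2 - m) * ellipticE m - 2 * (1 - m) * ellipticK m) / 3 := by
  have hK : IntervalIntegrable (fun φ => 1 / Real.sqrt (1 - m * Real.sin φ ^ 2)) volume 0
      (Real.pi / 2) := (intervalIntegrable_const (c := (1 : ℝ))).div_sqrt_one_sub_mul_sin_sq hm
  have hE := (continuous_sqrt_one_sub_mul_sin_sq m).intervalIntegrable (μ := volume) 0 (Real.pi / 2)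
  have hN := (continuous_mul_cos_sq_div_sqrt hm m).intervalIntegrable (μ := volume) 0 (Real.pi / 2)
  have hc : Continuous fun φ : ℝ => (1 - 2 * (1 + m) * Real.sin φ ^ 2 + 3 * m * Real.sin φ ^ 4) /
      Real.sqrt (1 - m * Real.sin φ ^ 2) :=
    Continuous.div (by fun_prop) (by fun_prop) fun φ => (sqrt_one_sub_mul_sin_sq_pos hm φ).ne'
  have hd := hc.intervalIntegrable (μ := volume) 0 (Real.pi / 2)
  have hftc := integral_eq_sub_of_hasDerivAt (a := 0) (b := Real.pi / 2)
    (fun φ _ => hasDerivAt_sin_mul_cos_mul_sqrt hm φ) hd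
  simp only [Real.sin_zero, Real.cos_pi_div_two, zero_mul, mul_zero, sub_zero] at hftc
  have hsplit : ∀ φ : ℝ, (c - m * Real.sin φ ^ 2) *
        (m * (Real.cos φ ^ 2 / Real.sqrt (1 - m * Real.sin φ ^ 2))) =
      c * (m * (Real.cos φ ^ 2 / Real.sqrt (1 - m * Real.sin φ ^ 2))) -
        ((2 - m) / 3 * Real.sqrt (1 - m * Real.sin φ ^ 2) -
          2 * (1 - m) / 3 * (1 / Real.sqrt (1 - m * Real.sin φ ^ 2))) +
        m / 3 * ((1 - 2 * (1 + m) * Real.sin φ ^ 2 + 3 * m * Real.sin φ ^ 4) /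
          Real.sqrt (1 - m * Real.sin φ ^ 2)) := fun φ => by
    have hp := sqrt_one_sub_mul_sin_sq_pos hm φ
    have hsq := sq_sqrt_one_sub_mul_sin_sq hm φ
    generalize Real.sqrt (1 - m * Real.sin φ ^ 2) = D at *
    have hcos := Real.cos_sq' φ
    field_simp
    rw [hsq, hcos]
    ring
  simp only [hsplit]
  rw [integral_add ((hN.const_mul _).sub ((hE.const_mul _).sub (hK.const_mul _))) (hd.const_mul _),
    integral_sub (hN.const_mul _) ((hE.const_mul _).sub (hK.const_mul _)),
    integral_sub (hE.const_mul _) (hK.const_mul _)]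
  simp only [intervalIntegral.integral_const_mul]
  rw [hftc]
  have hN' := integral_mul_cos_sq_div_sqrt hm
  rw [intervalIntegral.integral_const_mul] at hN'
  rw [hN', ← ellipticK, ← ellipticE]
  ring

theorem continuousOn_modulusIntegrand (ξ : ℝ) {m : ℝ} (hm : m < 1) (hm0 : 0 ≤ m) :
    ContinuousOn (modulusIntegrand ξ m) (Icc 0 (Real.sqrt m)) := by
  unfold modulusIntegrand
  refine ContinuousOn.mul (by fun_prop) (ContinuousOn.sqrt
    (ContinuousOn.div (by fun_prop) (by fun_prop) fun s hs => ?_))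
  have := (Real.le_sqrt hs.1 hm0).1 hs.2
  linarith

/-- The substitution `s = √m sin φ`. -/
theorem modulusIntegral_eq_integral (ξ : ℝ) {m : ℝ} (hm : m ∈ Ioo (0 : ℝ) 1) :
    modulusIntegral ξ m = ∫ φ in (0 : ℝ)..(Real.pi / 2), (ξ + (1 - m) / 2 - m * Real.sin φ ^ 2) *
        (m * (Real.cos φ ^ 2 / Real.sqrt (1 - m * Real.sin φ ^ 2))) := by
  have hpi := Real.pi_pos
  have hsm : Real.sqrt m ^ 2 = m := Real.sq_sqrt hm.1.le
  have hsm0 := Real.sqrt_nonneg m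
  have hu : uIcc 0 (Real.pi / 2) = Icc 0 (Real.pi / 2) := uIcc_of_le (by positivity)
  have h := integral_comp_mul_deriv' (a := 0) (b := Real.pi / 2)
    (f := fun φ => Real.sqrt m * Real.sin φ)
    (f' := fun φ => Real.sqrt m * Real.cos φ) (g := modulusIntegrand ξ m)
    (fun φ _ => (Real.hasDerivAt_sin φ).const_mul _) (by fun_prop)
    ((continuousOn_modulusIntegrand ξ hm.2 hm.1.le).mono (by
      rw [hu]
      rintro _ ⟨φ, hφ, rfl⟩
      have h0 : 0 ≤ Real.sin φ := Real.sin_nonneg_of_nonneg_of_le_pi hφ.1 (by linarith [hφ.2])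
      exact ⟨by positivity, mul_le_of_le_one_right hsm0 (Real.sin_le_one φ)⟩))
  simp only [Real.sin_zero, Real.sin_pi_div_two, mul_zero, mul_one] at h
  rw [modulusIntegral, ← h]
  refine integral_congr fun φ hφ => ?_
  rw [hu] at hφ
  have hc0 : 0 ≤ Real.cos φ := Real.cos_nonneg_of_mem_Icc ⟨by linarith [hφ.1], hφ.2⟩
  simp only [Function.comp_apply, modulusIntegrand, mul_pow, hsm]
  have hcos : m - m * Real.sin φ ^ 2 = (Real.sqrt m * Real.cos φ) ^ 2 := by
    rw [mul_pow, hsm, Real.cos_sq']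
    ring
  rw [hcos, Real.sqrt_div (sq_nonneg _), Real.sqrt_sq (by positivity)]
  generalize Real.sqrt (1 - m * Real.sin φ ^ 2) = D
  linear_combination (ξ + (1 - m) / 2 - m * Real.sin φ ^ 2) * (Real.cos φ ^ 2 / D) * hsm

theorem modulusIntegral_eq (ξ : ℝ) {m : ℝ} (hm : m ∈ Ioo (0 : ℝ) 1) :
    modulusIntegral ξ m = (ξ + (1 - m) / 2) * (ellipticE m - (1 - m) * ellipticK m) -
        ((2 - m) * ellipticE m - 2 * (1 - m) * ellipticK m) / 3 := by
  rw [modulusIntegral_eq_integral ξ hm, integral_sub_mul_sin_sq_mul_cos_sq_div_sqrt hm.2]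

theorem modulusIntegral_eq_zero_iff (ξ : ℝ) {m : ℝ} (hm : m ∈ Ioo (0 : ℝ) 1) :
    modulusIntegral ξ m = 0 ↔ 12 * ξ = gpSpeed m := by
  have hN := (ellipticE_sub_pos hm).ne'
  rw [modulusIntegral_eq ξ hm, gpSpeed, eq_sub_iff_add_eq, ← eq_sub_iff_add_eq', div_eq_iff hN]
  constructor <;> intro h <;> linarith

/-- Since `E - (1 - m) K` vanishes to first order at `0`, the factor `m` is cancelled first. -/
theorem tendsto_gpSpeed_zero : Filter.Tendsto gpSpeed (nhdsWithin 0 (Ioi 0)) (nhds (-6)) := by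
  have hpi := Real.pi_pos
  set P := weightedK fun φ => Real.cos φ ^ 2 with hP
  have hc : Continuous fun φ : ℝ => Real.cos φ ^ 2 := by fun_prop
  have hPc := (hasDerivAt_weightedK (hc.intervalIntegrable _ _) zero_lt_one).continuousAt
  rw [← hP] at hPc
  have hP0 : P 0 = Real.pi / 4 := by
    simp [hP, weightedK, integral_cos_sq]
    ring
  have hKc := (differentiableAt_ellipticK zero_lt_one).continuousAt
  have h : ContinuousAt (fun m => 2 * (1 + m) - 4 * (1 - m) * ellipticK m / P m) 0 := by
    have h0 : P 0 ≠ 0 := by rw [hP0]; positivity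
    fun_prop (disch := assumption)
  have ht := h.tendsto.mono_left (nhdsWithin_le_nhds (s := Ioi 0))
  simp only [hP0, ellipticK_zero] at ht
  convert ht.congr' ?_ using 2
  · field_simp
    norm_num
  · filter_upwards [Ioo_mem_nhdsGT (show (0 : ℝ) < 1 by norm_num)] with m hm
    have hN := ellipticE_sub_pos hm
    have hNP : ellipticE m - (1 - m) * ellipticK m = m * P m := by
      rw [← integral_mul_cos_sq_div_sqrt hm.2, intervalIntegral.integral_const_mul]
      rfl
    rw [hNP] at hN
    have hPm : P m ≠ 0 := (pos_of_mul_pos_right hN hm.1.le).ne'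
    have hm0 := hm.1.ne'
    rw [gpSpeed, hNP]
    field_simp

theorem tendsto_gpSpeed_one : Filter.Tendsto gpSpeed (nhdsWithin 1 (Iio 1)) (nhds 4) := by
  have hE := (continuous_ellipticE.tendsto 1).mono_left (nhdsWithin_le_nhds (s := Iio 1))
  rw [ellipticE_one] at hE
  have hK := ellipticK_mul_one_sub_tendsto
  have hid : Filter.Tendsto (fun m : ℝ => m) (nhdsWithin 1 (Iio 1)) (nhds 1) :=
    Filter.tendsto_id.mono_left nhdsWithin_le_nhds
  have h := ((hid.const_add 1).const_mul 2).sub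
    (((hid.const_mul 4).mul hK).div (hE.sub hK) (by norm_num))
  norm_num at h
  refine h.congr fun m => ?_
  rw [gpSpeed]
  ring

theorem exists_gpSpeed_eq {v : ℝ} (hv : v ∈ Ioo (-6 : ℝ) 4) : ∃ m ∈ Ioo (0 : ℝ) 1, gpSpeed m = v := by
  have hc : ContinuousOn gpSpeed (Ioo 0 1) := fun m hm => by
    have hK := (differentiableAt_ellipticK hm.2).continuousAt
    have hE := continuous_ellipticE.continuousAt (x := m)
    have hN := (ellipticE_sub_pos hm).ne'
    refine ContinuousAt.continuousWithinAt ?_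
    unfold gpSpeed
    fun_prop (disch := assumption)
  have h0 : nhdsWithin (0 : ℝ) (Ioi 0) ≤ Filter.principal (Ioo 0 1) :=
    Filter.le_principal_iff.2 (Ioo_mem_nhdsGT zero_lt_one)
  have h1 : nhdsWithin (1 : ℝ) (Iio 1) ≤ Filter.principal (Ioo 0 1) :=
    Filter.le_principal_iff.2 (Ioo_mem_nhdsLT zero_lt_one)
  exact isPreconnected_Ioo.intermediate_value_Ioo h0 h1 hc tendsto_gpSpeed_zero
    tendsto_gpSpeed_one hv

/-- The mean of `sin² φ` against the weight `cos² φ / √(1 - m sin² φ)` increases with `m`, because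
the quotient of the weights for two parameters is monotone in `sin² φ`. Hence the parameter is
determined by `ξ`. -/
theorem modulusIntegral_zero_unique {ξ m₁ m₂ : ℝ} (hξ : -(1 / 2) < ξ) (h₁ : m₁ ∈ Ioo (0 : ℝ) 1)
    (h₂ : m₂ ∈ Ioo (0 : ℝ) 1) (h12 : m₁ < m₂) (hz₁ : modulusIntegral ξ m₁ = 0)
    (hz₂ : modulusIntegral ξ m₂ = 0) : False := by
  have hpi : 0 < Real.pi / 2 := by linarith [Real.pi_pos]
  -- the mean of `sin² φ` prescribed by the equation
  set a : ℝ → ℝ := fun m => (ξ + 1 / 2) / m - 1 / 2 with ha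
  have hcont : ∀ m < 1, ∀ b, Continuous fun φ : ℝ => (b - Real.sin φ ^ 2) *
      (1 * (Real.cos φ ^ 2 / Real.sqrt (1 - m * Real.sin φ ^ 2))) := fun m hm b =>
    Continuous.mul (by fun_prop) (continuous_mul_cos_sq_div_sqrt hm 1)
  have hI : ∀ m < 1, ∀ b, IntervalIntegrable (fun φ : ℝ => (b - Real.sin φ ^ 2) *
      (1 * (Real.cos φ ^ 2 / Real.sqrt (1 - m * Real.sin φ ^ 2)))) volume 0 (Real.pi / 2) :=
    fun m hm b => (hcont m hm b).intervalIntegrable _ _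
  have hzero : ∀ m ∈ Ioo (0 : ℝ) 1, modulusIntegral ξ m = 0 →
      ∫ φ in (0 : ℝ)..(Real.pi / 2), (a m - Real.sin φ ^ 2) *
        (1 * (Real.cos φ ^ 2 / Real.sqrt (1 - m * Real.sin φ ^ 2))) = 0 := fun m hm hz => by
    have hm0 := hm.1.ne'
    rw [modulusIntegral_eq_integral ξ hm] at hz
    have : ∀ φ : ℝ, (ξ + (1 - m) / 2 - m * Real.sin φ ^ 2) *
        (m * (Real.cos φ ^ 2 / Real.sqrt (1 - m * Real.sin φ ^ 2))) =
        m ^ 2 * ((a m - Real.sin φ ^ 2) *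
          (1 * (Real.cos φ ^ 2 / Real.sqrt (1 - m * Real.sin φ ^ 2)))) := fun φ => by
      simp only [ha]
      generalize Real.cos φ ^ 2 / Real.sqrt (1 - m * Real.sin φ ^ 2) = w
      field_simp
      ring
    simp only [this, intervalIntegral.integral_const_mul] at hz
    exact (mul_eq_zero.1 hz).resolve_left (by positivity)
  have hcos : ∀ φ ∈ Ioo 0 (Real.pi / 2), 0 < Real.cos φ := fun φ hφ =>
    Real.cos_pos_of_mem_Ioo ⟨by linarith [hφ.1], hφ.2⟩
  have hz₁ := hzero m₁ h₁ hz₁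
  have hz₂ := hzero m₂ h₂ hz₂
  have ha12 : a m₂ < a m₁ := by
    have := h₁.1
    simp only [ha]
    gcongr
    linarith
  have ha1 : a m₂ < 1 := by
    by_contra! hge
    refine hz₂.not_gt (intervalIntegral_pos_of_pos_on (hI m₂ h₂.2 _) (fun φ hφ => ?_) hpi)
    have hc := hcos φ hφ
    have hp := sqrt_one_sub_mul_sin_sq_pos h₂.2 φ
    have hy : Real.sin φ ^ 2 < a m₂ := by nlinarith [Real.sin_sq_add_cos_sq φ]
    have := sub_pos.2 hy
    positivity
  have hq₁ : 0 < 1 - m₁ * a m₂ := by nlinarith [h₁.1, h₁.2]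
  have hq₂ : 0 < 1 - m₂ * a m₂ := by nlinarith [h₂.1, h₂.2]
  -- the quotient of the two weights at `sin² φ = a m₂`, where the sign of the integrand changes
  set r := Real.sqrt ((1 - m₁ * a m₂) / (1 - m₂ * a m₂)) with hr
  have hr0 : 0 < r := Real.sqrt_pos.2 (div_pos hq₁ hq₂)
  have hle : ∫ φ in (0 : ℝ)..(Real.pi / 2), (a m₂ - Real.sin φ ^ 2) *
        (1 * (Real.cos φ ^ 2 / Real.sqrt (1 - m₂ * Real.sin φ ^ 2))) ≤
      ∫ φ in (0 : ℝ)..(Real.pi / 2), r * ((a m₂ - Real.sin φ ^ 2) *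
        (1 * (Real.cos φ ^ 2 / Real.sqrt (1 - m₁ * Real.sin φ ^ 2)))) := by
    refine integral_mono_on hpi.le (hI m₂ h₂.2 _) ((hI m₁ h₁.2 _).const_mul r) fun φ _ => ?_
    have hp₁ := sqrt_one_sub_mul_sin_sq_pos h₁.2 φ
    have hp₂ := sqrt_one_sub_mul_sin_sq_pos h₂.2 φ
    have hy₁ := one_sub_mul_sin_sq_pos h₁.2 φ
    have hy₂ := one_sub_mul_sin_sq_pos h₂.2 φ
    have hrw : (a m₂ - Real.sin φ ^ 2) * (1 / Real.sqrt (1 - m₂ * Real.sin φ ^ 2)) ≤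
        (a m₂ - Real.sin φ ^ 2) * (r / Real.sqrt (1 - m₁ * Real.sin φ ^ 2)) := by
      rcases le_total (Real.sin φ ^ 2) (a m₂) with h | h
      · refine mul_le_mul_of_nonneg_left ?_ (sub_nonneg.2 h)
        rw [div_le_div_iff₀ hp₂ hp₁, one_mul, hr, ← Real.sqrt_mul (div_pos hq₁ hq₂).le]
        apply Real.sqrt_le_sqrt
        rw [div_mul_eq_mul_div, le_div_iff₀ hq₂]
        nlinarith [mul_nonneg (sub_nonneg.2 h12.le) (sub_nonneg.2 h)]
      · refine mul_le_mul_of_nonpos_left ?_ (sub_nonpos.2 h)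
        rw [div_le_div_iff₀ hp₁ hp₂, one_mul, hr, ← Real.sqrt_mul (div_pos hq₁ hq₂).le]
        apply Real.sqrt_le_sqrt
        rw [div_mul_eq_mul_div, div_le_iff₀ hq₂]
        nlinarith [mul_nonneg (sub_nonneg.2 h12.le) (sub_nonneg.2 h)]
    calc _ = Real.cos φ ^ 2 * ((a m₂ - Real.sin φ ^ 2) *
          (1 / Real.sqrt (1 - m₂ * Real.sin φ ^ 2))) := by ring
      _ ≤ Real.cos φ ^ 2 * ((a m₂ - Real.sin φ ^ 2) *
          (r / Real.sqrt (1 - m₁ * Real.sin φ ^ 2))) := by gcongr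
      _ = _ := by ring
  rw [hz₂, intervalIntegral.integral_const_mul] at hle
  have hlt : 0 < (∫ φ in (0 : ℝ)..(Real.pi / 2), (a m₁ - Real.sin φ ^ 2) *
        (1 * (Real.cos φ ^ 2 / Real.sqrt (1 - m₁ * Real.sin φ ^ 2)))) -
      ∫ φ in (0 : ℝ)..(Real.pi / 2), (a m₂ - Real.sin φ ^ 2) *
        (1 * (Real.cos φ ^ 2 / Real.sqrt (1 - m₁ * Real.sin φ ^ 2))) := by
    rw [← integral_sub (hI m₁ h₁.2 _) (hI m₁ h₁.2 _)]
    refine intervalIntegral_pos_of_pos_on ((hI m₁ h₁.2 _).sub (hI m₁ h₁.2 _)) (fun φ hφ => ?_) hpi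
    have hc := hcos φ hφ
    have hp := sqrt_one_sub_mul_sin_sq_pos h₁.2 φ
    rw [← sub_mul, sub_sub_sub_cancel_right]
    have := sub_pos.2 ha12
    positivity
  rw [hz₁, zero_sub] at hlt
  nlinarith

theorem existsUnique_isStepModulus {ξ : ℝ} (hξ : ξ ∈ Ioo (-(1 / 2) : ℝ) (1 / 3)) :
    ∃! m : ℝ, IsStepModulus ξ m := by
  obtain ⟨m, hm, h⟩ := exists_gpSpeed_eq (v := 12 * ξ) ⟨by linarith [hξ.1], by linarith [hξ.2]⟩
  have hz := (modulusIntegral_eq_zero_iff ξ hm).2 h.symm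
  refine ⟨m, ⟨hm, hz⟩, fun y hy => ?_⟩
  rcases lt_trichotomy y m with hlt | heq | hgt
  · exact (modulusIntegral_zero_unique hξ.1 hy.1 hm hlt hy.2 hz).elim
  · exact heq
  · exact (modulusIntegral_zero_unique hξ.1 hm hy.1 hgt hz hy.2).elim

/-! ### The substitutions in the singular integrals -/

section Substitution

variable {a b c d : ℝ} {f f' : ℝ → ℝ}

/-- Change of variables between open intervals, without any regularity of the integrand at the
endpoints. -/
theorem integral_eq_integral_of_bijOn_Ioo (hab : a ≤ b) (hcd : c ≤ d)
    (hf : ∀ x ∈ Ioo a b, HasDerivAt f (f' x) x) (hbij : BijOn f (Ioo a b) (Ioo c d)) (g : ℝ → ℝ) :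
    ∫ s in c..d, g s = ∫ φ in a..b, |f' φ| * g (f φ) := by
  rw [integral_of_le hab, integral_of_le hcd, integral_Ioc_eq_integral_Ioo,
    integral_Ioc_eq_integral_Ioo, ← hbij.image_eq]
  exact integral_image_eq_integral_abs_deriv_smul measurableSet_Ioo
    (fun x hx => (hf x hx).hasDerivWithinAt) hbij.injOn g

theorem intervalIntegrable_iff_of_bijOn_Ioo (hab : a ≤ b) (hcd : c ≤ d)
    (hf : ∀ x ∈ Ioo a b, HasDerivAt f (f' x) x) (hbij : BijOn f (Ioo a b) (Ioo c d)) (g : ℝ → ℝ) :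
    IntervalIntegrable g volume c d ↔
      IntervalIntegrable (fun φ => |f' φ| * g (f φ)) volume a b := by
  rw [intervalIntegrable_iff_integrableOn_Ioo_of_le hab,
    intervalIntegrable_iff_integrableOn_Ioo_of_le hcd, ← hbij.image_eq]
  exact integrableOn_image_iff_integrableOn_abs_deriv_smul measurableSet_Ioo
    (fun x hx => (hf x hx).hasDerivWithinAt) hbij.injOn g

end Substitution

theorem intervalIntegrable_congr_Ioo {a b : ℝ} {f g : ℝ → ℝ} (hab : a ≤ b)
    (h : EqOn f g (Ioo a b)) :
    IntervalIntegrable f volume a b ↔ IntervalIntegrable g volume a b := by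
  rw [intervalIntegrable_iff_integrableOn_Ioo_of_le hab,
    intervalIntegrable_iff_integrableOn_Ioo_of_le hab]
  exact integrableOn_congr_fun h measurableSet_Ioo

theorem sin_pos_and_cos_pos {φ : ℝ} (hφ : φ ∈ Ioo 0 (Real.pi / 2)) :
    0 < Real.sin φ ∧ 0 < Real.cos φ :=
  ⟨Real.sin_pos_of_pos_of_lt_pi hφ.1 (by linarith [hφ.2, Real.pi_pos]),
    Real.cos_pos_of_mem_Ioo ⟨by linarith [hφ.1, Real.pi_pos], hφ.2⟩⟩

section Dn

variable {m : ℝ}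

/-- The function `dn` of parameter `1 - m`, in terms of the amplitude `φ`, maps `(0, π/2)` onto the
range of integration of the phase integrals. -/
theorem bijOn_dn (hm : m ∈ Ioo (0 : ℝ) 1) :
    BijOn (fun φ => Real.sqrt (1 - (1 - m) * Real.sin φ ^ 2)) (Ioo 0 (Real.pi / 2))
      (Ioo (Real.sqrt m) 1) := by
  have hpi := Real.pi_pos
  have hn : 0 < 1 - m := by linarith [hm.2]
  have hn1 : 1 - m < 1 := by linarith [hm.1]
  have hsin : ∀ φ ∈ Ioo 0 (Real.pi / 2), 0 < Real.sin φ := fun φ hφ =>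
    Real.sin_pos_of_pos_of_lt_pi hφ.1 (by linarith [hφ.2])
  refine ⟨fun φ hφ => ⟨?_, ?_⟩, fun φ hφ ψ hψ h => ?_, fun s hs => ?_⟩
  · apply Real.sqrt_lt_sqrt hm.1.le
    have hc := Real.cos_pos_of_mem_Ioo (x := φ) ⟨by linarith [hφ.1], hφ.2⟩
    nlinarith [Real.sin_sq_add_cos_sq φ, mul_pos hn (pow_pos hc 2)]
  · rw [Real.sqrt_lt' one_pos]
    nlinarith [mul_pos hn (pow_pos (hsin φ hφ) 2)]
  · have h2 : (1 - m) * Real.sin φ ^ 2 = (1 - m) * Real.sin ψ ^ 2 := by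
      have := congrArg (· ^ 2) h
      simp only [sq_sqrt_one_sub_mul_sin_sq hn1] at this
      linarith
    have h3 := mul_left_cancel₀ hn.ne' h2
    have h4 := (pow_left_inj₀ (hsin φ hφ).le (hsin ψ hψ).le two_ne_zero).1 h3
    exact Real.injOn_sin ⟨by linarith [hφ.1], hφ.2.le⟩ ⟨by linarith [hψ.1], hψ.2.le⟩ h4
  · have hs0 : 0 < s := lt_of_le_of_lt (Real.sqrt_nonneg m) hs.1
    have hsm : m < s ^ 2 := (Real.sqrt_lt' hs0).1 hs.1
    have hs1 : s ^ 2 < 1 := by nlinarith [hs.2]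
    have hq0 : 0 < (1 - s ^ 2) / (1 - m) := div_pos (by linarith) hn
    have hq1 : (1 - s ^ 2) / (1 - m) < 1 := by rw [div_lt_one hn]; linarith
    have hr0 : 0 < Real.sqrt ((1 - s ^ 2) / (1 - m)) := Real.sqrt_pos.2 hq0
    have hr1 : Real.sqrt ((1 - s ^ 2) / (1 - m)) < 1 := by
      rw [Real.sqrt_lt' one_pos]
      simpa using hq1
    refine ⟨Real.arcsin (Real.sqrt ((1 - s ^ 2) / (1 - m))),
      ⟨Real.arcsin_pos.2 hr0, Real.arcsin_lt_pi_div_two.2 hr1⟩, ?_⟩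
    simp only
    rw [Real.sin_arcsin (by linarith) hr1.le, Real.sq_sqrt hq0.le, mul_div_cancel₀ _ hn.ne',
      sub_sub_cancel, Real.sqrt_sq hs0.le]

theorem hasDerivAt_dn (hm : 0 < m) (φ : ℝ) :
    HasDerivAt (fun φ => Real.sqrt (1 - (1 - m) * Real.sin φ ^ 2))
      (-((1 - m) * Real.sin φ * Real.cos φ / Real.sqrt (1 - (1 - m) * Real.sin φ ^ 2))) φ := by
  have hn1 : 1 - m < 1 := by linarith
  have h1 : HasDerivAt (fun φ : ℝ => 1 - (1 - m) * Real.sin φ ^ 2)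
      (-((1 - m) * (2 * Real.sin φ * Real.cos φ))) φ := by
    simpa using (((Real.hasDerivAt_sin φ).pow 2).const_mul (1 - m)).const_sub 1
  refine (h1.sqrt (one_sub_mul_sin_sq_pos hn1 φ).ne').congr_deriv ?_
  have hp := sqrt_one_sub_mul_sin_sq_pos hn1 φ
  generalize Real.sqrt (1 - (1 - m) * Real.sin φ ^ 2) = D at *
  field_simp

/-- The substitution `s = √(1 - (1 - m) sin² φ)`, in a form in which `G` collects the integrand
and the Jacobian. -/
theorem integral_eq_integral_dn (hm : m ∈ Ioo (0 : ℝ) 1) {g G : ℝ → ℝ}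
    (h : ∀ φ ∈ Ioo 0 (Real.pi / 2), (1 - m) * Real.sin φ * Real.cos φ /
      Real.sqrt (1 - (1 - m) * Real.sin φ ^ 2) *
        g (Real.sqrt (1 - (1 - m) * Real.sin φ ^ 2)) = G φ) :
    (∫ s in (Real.sqrt m)..1, g s = ∫ φ in (0 : ℝ)..(Real.pi / 2), G φ) ∧
      (IntervalIntegrable g volume (Real.sqrt m) 1 ↔
        IntervalIntegrable G volume 0 (Real.pi / 2)) := by
  have hpi : 0 ≤ Real.pi / 2 := by linarith [Real.pi_pos]
  have hm1 : Real.sqrt m ≤ 1 := Real.sqrt_le_one.2 hm.2.le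
  have hG : EqOn (fun φ => |(-((1 - m) * Real.sin φ * Real.cos φ /
      Real.sqrt (1 - (1 - m) * Real.sin φ ^ 2)))| *
        g (Real.sqrt (1 - (1 - m) * Real.sin φ ^ 2))) G (Ioo 0 (Real.pi / 2)) := fun φ hφ => by
    have hn : 0 < 1 - m := by linarith [hm.2]
    obtain ⟨h0, hc⟩ := sin_pos_and_cos_pos hφ
    simp only
    rw [abs_neg, abs_of_nonneg (by positivity), h φ hφ]
  constructor
  · rw [integral_eq_integral_of_bijOn_Ioo hpi hm1 (fun φ _ => hasDerivAt_dn hm.1 φ) (bijOn_dn hm) g]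
    exact integral_congr_Ioo_of_le hpi hG
  · rw [intervalIntegrable_iff_of_bijOn_Ioo hpi hm1 (fun φ _ => hasDerivAt_dn hm.1 φ)
      (bijOn_dn hm) g]
    exact intervalIntegrable_congr_Ioo hpi hG

/-- The two factors below the square roots of the phase integrands, at
`s = √(1 - (1 - m) sin² φ)`. -/
theorem one_sub_dn_sq_and_dn_sq_sub (hm : 0 < m) (φ : ℝ) :
    1 - Real.sqrt (1 - (1 - m) * Real.sin φ ^ 2) ^ 2 = (1 - m) * Real.sin φ ^ 2 ∧
      Real.sqrt (1 - (1 - m) * Real.sin φ ^ 2) ^ 2 - m = (1 - m) * Real.cos φ ^ 2 := by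
  rw [sq_sqrt_one_sub_mul_sin_sq (by linarith), Real.cos_sq']
  constructor <;> ring

/-! ### The leading phase -/

/-- Up to sign the integral is that of the equation for the parameter, with `m` replaced by `1 - m`
and the constant `ξ + (1 - m) / 2` by its complement to `1`. -/
theorem istB_integral (hm : m ∈ Ioo (0 : ℝ) 1) (ξ : ℝ) :
    IntervalIntegrable (istBIntegrand ξ m) volume (Real.sqrt m) 1 ∧
      istB ξ m = 24 * ((ξ + (1 - m) / 2 - 1) * (ellipticE (1 - m) - m * ellipticK (1 - m)) +
        ((1 + m) * ellipticE (1 - m) - 2 * m * ellipticK (1 - m)) / 3) := by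
  have hn : 0 < 1 - m := by linarith [hm.2]
  have hn1 : 1 - m < 1 := by linarith [hm.1]
  have h := integral_eq_integral_dn hm (g := istBIntegrand ξ m)
    (G := fun φ => -((1 - (ξ + (1 - m) / 2) - (1 - m) * Real.sin φ ^ 2) *
      ((1 - m) * (Real.cos φ ^ 2 / Real.sqrt (1 - (1 - m) * Real.sin φ ^ 2))))) fun φ hφ => by
    obtain ⟨h0, hc⟩ := sin_pos_and_cos_pos hφ
    have hp := sqrt_one_sub_mul_sin_sq_pos hn1 φ
    obtain ⟨h1, h2⟩ := one_sub_dn_sq_and_dn_sq_sub hm.1 φ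
    rw [istBIntegrand, h1, h2, mul_div_mul_left _ _ hn.ne', ← div_pow,
      Real.sqrt_sq (by positivity)]
    generalize Real.sqrt (1 - (1 - m) * Real.sin φ ^ 2) = D at *
    have hD : D ^ 2 = 1 - (1 - m) * Real.sin φ ^ 2 := by linarith
    rw [hD]
    field_simp
    ring
  have hcont : Continuous fun φ : ℝ => -((1 - (ξ + (1 - m) / 2) - (1 - m) * Real.sin φ ^ 2) *
      ((1 - m) * (Real.cos φ ^ 2 / Real.sqrt (1 - (1 - m) * Real.sin φ ^ 2)))) :=
    (Continuous.mul (by fun_prop) (continuous_mul_cos_sq_div_sqrt hn1 (1 - m))).neg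
  refine ⟨h.2.2 (hcont.intervalIntegrable _ _), ?_⟩
  rw [istB, h.1, intervalIntegral.integral_neg,
    integral_sub_mul_sin_sq_mul_cos_sq_div_sqrt hn1]
  ring

/-- On solutions of the equation for the parameter, Legendre's relation collapses the leading
phase. -/
theorem istB_eq {ξ : ℝ} (hm : IsStepModulus ξ m) :
    istB ξ m = -(4 * Real.pi * m * (1 - m) / (ellipticE m - (1 - m) * ellipticK m)) := by
  obtain ⟨hm, hz⟩ := hm
  have hN := (ellipticE_sub_pos hm).ne'
  rw [modulusIntegral_eq ξ hm] at hz
  have hleg := legendre_relation hm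
  rw [(istB_integral hm ξ).2, ← neg_div, eq_div_iff hN]
  linear_combination (24 * (ellipticE (1 - m) - m * ellipticK (1 - m))) * hz -
    8 * m * (1 - m) * hleg

/-! ### The phase shift -/

/-- The involution `s ↦ √m / s` of `(√m, 1)`. -/
theorem bijOn_sqrt_div (hm : m ∈ Ioo (0 : ℝ) 1) :
    BijOn (fun s => Real.sqrt m / s) (Ioo (Real.sqrt m) 1) (Ioo (Real.sqrt m) 1) := by
  have hq : 0 < Real.sqrt m := Real.sqrt_pos.2 hm.1
  have hmaps : MapsTo (fun s => Real.sqrt m / s) (Ioo (Real.sqrt m) 1) (Ioo (Real.sqrt m) 1) := by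
    intro s hs
    have hs0 : 0 < s := hq.trans hs.1
    constructor
    · rw [lt_div_iff₀ hs0]
      nlinarith [hs.2]
    · rw [div_lt_one hs0]
      exact hs.1
  have hinv : ∀ s ∈ Ioo (Real.sqrt m) 1, Real.sqrt m / (Real.sqrt m / s) = s := fun s _ =>
    div_div_cancel₀ hq.ne'
  exact InvOn.bijOn ⟨hinv, hinv⟩ hmaps hmaps

/-- The integral of `log (dn u)` over a quarter period, by the symmetry `s ↦ √m / s` of the
differential `ds / √((1 - s²) (s² - m))`. -/
theorem integral_log_dn (hm : m ∈ Ioo (0 : ℝ) 1) :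
    IntervalIntegrable (fun φ => Real.log (Real.sqrt (1 - (1 - m) * Real.sin φ ^ 2)) /
      Real.sqrt (1 - (1 - m) * Real.sin φ ^ 2)) volume 0 (Real.pi / 2) ∧
    ∫ φ in (0 : ℝ)..(Real.pi / 2), Real.log (Real.sqrt (1 - (1 - m) * Real.sin φ ^ 2)) /
      Real.sqrt (1 - (1 - m) * Real.sin φ ^ 2) = ellipticK (1 - m) * Real.log m / 4 := by
  have hn : 0 < 1 - m := by linarith [hm.2]
  have hn1 : 1 - m < 1 := by linarith [hm.1]
  have hq : 0 < Real.sqrt m := Real.sqrt_pos.2 hm.1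
  have hq2 : Real.sqrt m ^ 2 = m := Real.sq_sqrt hm.1.le
  have hm1 : Real.sqrt m ≤ 1 := Real.sqrt_le_one.2 hm.2.le
  -- the substitution for an arbitrary factor in place of the logarithm
  have hsub : ∀ p : ℝ → ℝ, _ := fun p => integral_eq_integral_dn hm
    (g := fun s => p s / Real.sqrt ((1 - s ^ 2) * (s ^ 2 - m)))
    (G := fun φ => p (Real.sqrt (1 - (1 - m) * Real.sin φ ^ 2)) /
      Real.sqrt (1 - (1 - m) * Real.sin φ ^ 2)) fun φ hφ => by
    obtain ⟨h0, hc⟩ := sin_pos_and_cos_pos hφ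
    have hp := sqrt_one_sub_mul_sin_sq_pos hn1 φ
    obtain ⟨h1, h2⟩ := one_sub_dn_sq_and_dn_sq_sub hm.1 φ
    have h3 : (1 - m) * Real.sin φ ^ 2 * ((1 - m) * Real.cos φ ^ 2) =
        ((1 - m) * Real.sin φ * Real.cos φ) ^ 2 := by ring
    rw [h1, h2, h3, Real.sqrt_sq (by positivity)]
    generalize Real.sqrt (1 - (1 - m) * Real.sin φ ^ 2) = D at *
    field_simp
  have hlc : Continuous fun φ : ℝ => Real.log (Real.sqrt (1 - (1 - m) * Real.sin φ ^ 2)) :=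
    (continuous_sqrt_one_sub_mul_sin_sq _).log fun φ => (sqrt_one_sub_mul_sin_sq_pos hn1 φ).ne'
  have hI := (hlc.intervalIntegrable (μ := volume) 0 (Real.pi / 2)).div_sqrt_one_sub_mul_sin_sq hn1
  refine ⟨hI, ?_⟩
  have h1 := hsub fun _ => 1
  have hlog := hsub Real.log
  have hw := h1.2.2 ((intervalIntegrable_const (c := (1 : ℝ))).div_sqrt_one_sub_mul_sin_sq hn1)
  have hlw := hlog.2.2 hI
  rw [← hlog.1]
  have hrefl := integral_eq_integral_of_bijOn_Ioo hm1 hm1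
    (f' := fun s => Real.sqrt m * -(s ^ 2)⁻¹)
    (fun s hs => by
      simpa only [div_eq_mul_inv] using
        (hasDerivAt_inv (hq.trans hs.1).ne').const_mul (Real.sqrt m))
    (bijOn_sqrt_div hm) (fun s => Real.log s / Real.sqrt ((1 - s ^ 2) * (s ^ 2 - m)))
  have hcongr : ∫ s in (Real.sqrt m)..1, |Real.sqrt m * -(s ^ 2)⁻¹| *
        (Real.log (Real.sqrt m / s) /
          Real.sqrt ((1 - (Real.sqrt m / s) ^ 2) * ((Real.sqrt m / s) ^ 2 - m))) =
      ∫ s in (Real.sqrt m)..1, (Real.log (Real.sqrt m) *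
        (1 / Real.sqrt ((1 - s ^ 2) * (s ^ 2 - m))) -
          Real.log s / Real.sqrt ((1 - s ^ 2) * (s ^ 2 - m))) := by
    refine integral_congr_Ioo_of_le hm1 fun s hs => ?_
    have hs0 : 0 < s := hq.trans hs.1
    have hs1 : 0 < 1 - s ^ 2 := by nlinarith [hs.2]
    have hsm : 0 < s ^ 2 - m := sub_pos.2 ((Real.sqrt_lt' hs0).1 hs.1)
    have hW := Real.sqrt_pos.2 (mul_pos hs1 hsm)
    have hkey : (1 - (Real.sqrt m / s) ^ 2) * ((Real.sqrt m / s) ^ 2 - m) =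
        (Real.sqrt m / s ^ 2) ^ 2 * ((1 - s ^ 2) * (s ^ 2 - m)) := by
      rw [div_pow, div_pow, hq2]
      field_simp
    rw [hkey, Real.sqrt_mul (sq_nonneg _), Real.sqrt_sq (by positivity),
      Real.log_div hq.ne' hs0.ne', mul_neg, abs_neg, abs_of_pos (by positivity)]
    generalize Real.sqrt ((1 - s ^ 2) * (s ^ 2 - m)) = W at *
    field_simp
  rw [hcongr, integral_sub (hw.const_mul _) hlw, intervalIntegral.integral_const_mul, h1.1,
    Real.log_sqrt hm.1.le] at hrefl
  change _ = _ * ellipticK (1 - m) - _ at hrefl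
  linarith

/-- At `s = dn` the logarithm splits into `log (4 √(1 - m)) + log dn + log sn`. -/
theorem istDelta_integral (hm : m ∈ Ioo (0 : ℝ) 1) :
    IntervalIntegrable (istDeltaIntegrand m) volume (Real.sqrt m) 1 ∧
      ∫ s in (Real.sqrt m)..1, istDeltaIntegrand m s =
        ellipticK (1 - m) * (Real.log 4 + Real.log (m * (1 - m)) / 4) -
          Real.pi / 4 * ellipticK m := by
  have hn : 0 < 1 - m := by linarith [hm.2]
  have hn1 : 1 - m < 1 := by linarith [hm.1]
  have hq : 0 < Real.sqrt (1 - m) := Real.sqrt_pos.2 hn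
  have h := integral_eq_integral_dn hm (g := istDeltaIntegrand m)
    (G := fun φ => Real.log (4 * Real.sqrt (1 - m)) *
        (1 / Real.sqrt (1 - (1 - m) * Real.sin φ ^ 2)) +
      Real.log (Real.sqrt (1 - (1 - m) * Real.sin φ ^ 2)) /
        Real.sqrt (1 - (1 - m) * Real.sin φ ^ 2) +
      Real.log (Real.sin φ) / Real.sqrt (1 - (1 - m) * Real.sin φ ^ 2)) fun φ hφ => by
    obtain ⟨h0, hc⟩ := sin_pos_and_cos_pos hφ
    have hp := sqrt_one_sub_mul_sin_sq_pos hn1 φ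
    obtain ⟨h1, h2⟩ := one_sub_dn_sq_and_dn_sq_sub hm.1 φ
    have h3 : (1 - m) * Real.sin φ ^ 2 * ((1 - m) * Real.cos φ ^ 2) =
        ((1 - m) * Real.sin φ * Real.cos φ) ^ 2 := by ring
    rw [istDeltaIntegrand, h1, h2, h3, Real.sqrt_sq (by positivity), Real.sqrt_mul hn.le,
      Real.sqrt_sq h0.le]
    generalize Real.sqrt (1 - (1 - m) * Real.sin φ ^ 2) = D at *
    have h4 : 4 * D * (Real.sqrt (1 - m) * Real.sin φ) =
        4 * Real.sqrt (1 - m) * D * Real.sin φ := by ring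
    rw [h4, Real.log_mul (by positivity) h0.ne', Real.log_mul (by positivity) hp.ne']
    field_simp
  have hI1 : IntervalIntegrable (fun φ => 1 / Real.sqrt (1 - (1 - m) * Real.sin φ ^ 2)) volume 0
      (Real.pi / 2) := (intervalIntegrable_const (c := (1 : ℝ))).div_sqrt_one_sub_mul_sin_sq hn1
  obtain ⟨hI2, hdn⟩ := integral_log_dn hm
  have hI3 := intervalIntegrable_log_sin_half_pi.div_sqrt_one_sub_mul_sin_sq hn1
  refine ⟨h.2.2 (((hI1.const_mul _).add hI2).add hI3), ?_⟩
  rw [h.1, integral_add ((hI1.const_mul _).add hI2) hI3, integral_add (hI1.const_mul _) hI2,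
    intervalIntegral.integral_const_mul, hdn, ← ellipticK]
  have hsn := weightedK_log_sin (m := 1 - m) ⟨hn, hn1⟩
  rw [sub_sub_cancel, weightedK] at hsn
  rw [hsn, Real.log_mul (by norm_num) hq.ne', Real.log_sqrt hn.le,
    Real.log_mul hm.1.ne' hn.ne']
  ring

theorem istDelta_eq (hm : m ∈ Ioo (0 : ℝ) 1) :
    istDelta m = ellipticK (1 - m) / ellipticK m *
      Real.log (4 * (m * (1 - m)) ^ (1 / 4 : ℝ)) - Real.pi / 4 := by
  have hn : 0 < 1 - m := by linarith [hm.2]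
  have hK := (ellipticK_pos hm.2).ne'
  have hp : 0 < m * (1 - m) := mul_pos hm.1 hn
  have hr : (m * (1 - m)) ^ (1 / 4 : ℝ) ≠ 0 := (Real.rpow_pos_of_pos hp _).ne'
  rw [istDelta, (istDelta_integral hm).2, Real.log_mul (by norm_num : (4 : ℝ) ≠ 0) hr,
    Real.log_rpow hp]
  field_simp

end Dn

theorem mainTheorem4 (ε x t σ : ℝ) (hε : 0 < ε) (ht : 0 < t)
    (hx : x ∈ Set.Ioo (-6 * t) (4 * t)) (hσ : σ = 1 ∨ σ = -1) :
    -- the elliptic parameter is well defined by its implicit equation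
    (∃! m : ℝ, IsStepModulus (x / (12 * t)) m) ∧
    -- the implicit equation is the Gurevich-Pitaevskii equation
    (∀ m ∈ Set.Ioo (0 : ℝ) 1,
      IntervalIntegrable (modulusIntegrand (x / (12 * t)) m) MeasureTheory.volume 0 (Real.sqrt m) ∧
      (modulusIntegral (x / (12 * t)) m = 0 ↔ x / t = gpSpeed m)) ∧
    ∀ m : ℝ, IsStepModulus (x / (12 * t)) m →
      -- the integrals in the phase converge
      IntervalIntegrable (istBIntegrand (x / (12 * t)) m) MeasureTheory.volume (Real.sqrt m) 1 ∧
      IntervalIntegrable (istDeltaIntegrand m) MeasureTheory.volume (Real.sqrt m) 1 ∧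
      DifferentiableAt ℝ ellipticK m ∧
      0 < ellipticK m ∧ 0 < ellipticE m - (1 - m) * ellipticK m ∧
      -- the leading part
      istLeadingPhase ε x t m = whithamFastPhase ε t m ∧
      istLeadingPhase ε x t m =
        -(t / ε) * (2 * m * (1 - m) / (ellipticE m - (1 - m) * ellipticK m)) ∧
      -- the shift of order one
      istPhaseShift σ m =
        ellipticK (1 - m) / (2 * Real.pi * ellipticK m) *
          Real.log (4 * (m * (1 - m)) ^ (1 / 4 : ℝ)) - 1 / 8 + σ / 2 ∧
      -- the total phase
      istTotalPhase σ ε x t m =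
        -(t / ε) * (2 * m * (1 - m) / (ellipticE m - (1 - m) * ellipticK m)) +
          (ellipticK (1 - m) / (2 * Real.pi * ellipticK m) *
            Real.log (4 * (m * (1 - m)) ^ (1 / 4 : ℝ)) - 1 / 8 + σ / 2) := by
  have hpi := Real.pi_pos
  have h12 : 12 * (x / (12 * t)) = x / t := by field_simp
  refine ⟨existsUnique_isStepModulus ⟨?_, ?_⟩, fun m hm => ⟨?_, ?_⟩, fun m hm => ?_⟩
  · rw [lt_div_iff₀ (by positivity)]
    linarith [hx.1]
  · rw [div_lt_iff₀ (by positivity)]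
    linarith [hx.2]
  · refine ContinuousOn.intervalIntegrable ?_
    rw [uIcc_of_le (Real.sqrt_nonneg m)]
    exact continuousOn_modulusIntegrand _ hm.2 hm.1.le
  · rw [modulusIntegral_eq_zero_iff _ hm, h12]
  · have hm' := hm.1
    have hN := ellipticE_sub_pos hm'
    have hK := ellipticK_pos hm'.2
    have hn : 1 - m ≠ 0 := by linarith [hm'.2]
    have hm0 := hm'.1.ne'
    have hlead : istLeadingPhase ε x t m =
        -(t / ε) * (2 * m * (1 - m) / (ellipticE m - (1 - m) * ellipticK m)) := by
      rw [istLeadingPhase, istB_eq hm]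
      field_simp
      ring
    have hshift : istPhaseShift σ m =
        ellipticK (1 - m) / (2 * Real.pi * ellipticK m) *
          Real.log (4 * (m * (1 - m)) ^ (1 / 4 : ℝ)) - 1 / 8 + σ / 2 := by
      rw [istPhaseShift, istDelta_eq hm']
      field_simp
      ring
    refine ⟨(istB_integral hm' _).1, (istDelta_integral hm').1, differentiableAt_ellipticK hm'.2,
      hK, hN, ?_, hlead, hshift, ?_⟩
    · rw [hlead, whithamFastPhase, (hasDerivAt_ellipticK hm'.2 hm0).deriv]
      field_simp
    · rw [← hlead, ← hshift, istTotalPhase, istLeadingPhase, istPhaseShift, add_assoc]
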